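/- **Setup.** Let $n\ge 2$, let $V=\{a\in\mathbb R^n : \sum_i a_i=0\}$ with the standard inner product, and let $\alpha_i=\varepsilon_i-\varepsilon_{i+1}$ $(1\le i<n)$, $\theta=\varepsilon_1-\varepsilon_n$; positive roots are the $\varepsilon_i-\varepsilon_j$ with $i<j$. Put $H_{\alpha,k}=\{v\in V:\langle v,\alpha\rangle=k\}$. Alcoves are the connected components of $V\setminus\bigcup_{\alpha>0,\,k\in\mathbb Z}H_{\alpha,k}$. The dominant chamber is $\{v\in V:\langle v,\alpha_i\rangle\ge 0,\ 1\le i<n\}$, and $\mathcal A_0$ is the interior of its intersection with $\{\langle v,\theta\rangle\le 1\}$. For $m\ge 0$, the regions of the $m$-Shi arrangement are the connected components of $V\setminus\bigcup_{\alpha>0,\,-m<k\le m}H_{\alpha,k}$; a region is dominant if it lies in the dominant chamber. The affine symmetric group $\widehat{\mathcal S}_n$ is the group of transformations of $V$ generated by $s_1,\dots,s_{n-1}$, where $s_i$ exchanges the coordinates $a_i,a_{i+1}$, and $s_0(a_1,\dots,a_n)=(a_n+1,a_2,\dots,a_{n-1},a_1-1)$. Let $\ell$ be word length in these generators and $\mathcal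 S_n=\langle s_1,\dots,s_{n-1}\rangle$. Call $w\in\widehat{\mathcal S}_n$ *minimal* if it has minimal length in its left coset $w\mathcal S_n$. An alcove $w\mathcal A_0$ is *$m$-minimal* if $\ell(w)$ is smallest among all alcoves $w'\mathcal A_0$ contained in the same region of the $m$-Shi arrangement. A partition is a $t$-core if none of its hook lengths is divisible by $t$. The box in row $x$ and column $y$ has residue $y-x \bmod n$. For an $n$-core $\lambda$, let $s_i\lambda$ $(0\le i<n)$ be obtained by adding all addable boxes of residue $i$ if there are any, otherwise by removing all removable boxes of residue $i$ if there are any, and otherwise let $s_i\lambda=\lambda$. **Theorem.** The rule above defines an action of $\widehat{\mathcal S}_n$ on the set of $n$-cores, and every $n$-core equals $w\emptyset$ for exactly one minimal $w$. Let $\Phi$ be the map sending $w\emptyset$, with $w$ minimal, to $w^{-1}\mathcal A_0$. 1. $\Phi$ is a bijection from the set of $n$-cores to the set of alcoves in the dominant chamber. 2. $\Phi$ commutes with the left action of $\widehat{\mathcal S}_n$ on $n$-cores and its right action on alcoves taken modulo $\mathcal S_n$: if $\lambda$ is an $n$-core, $\Phi(\lambda)=x\mathcal A_0$ and $g\in\widehat{\mathcal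 S}_n$, then $\Phi(g\lambda)=u\,x g^{-1}\mathcal A_0$ for some $u\in\mathcal S_n$; and $\Phi(g\lambda)=xg^{-1}\mathcal A_0$ whenever $xg^{-1}\mathcal A_0$ lies in the dominant chamber. 3. For every $m\ge 0$, $\Phi$ restricts to a bijection from the set of partitions that are both $n$-cores and $(mn+1)$-cores to the set of $m$-minimal alcoves in the dominant chamber. 4. If $m\ge 1$, then each $m$-minimal alcove in the dominant chamber lies in exactly one dominant region of the $m$-Shi arrangement, and each dominant region contains exactly one $m$-minimal alcove. -/

import Mathlib

noncomputable section

namespace ShiCore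

/-! ### The space `V`, roots and hyperplanes

Coordinates are indexed by `Fin n`, starting from `0`; subtraction in `Fin n` is cyclic, so that
`(-1 : Fin n)` is the last index. -/

/-- `V`: the vectors of `ℝⁿ` whose coordinates sum to zero. -/
def V (n : ℕ) : Submodule ℝ (Fin n → ℝ) where
  carrier := {a | ∑ i, a i = 0}
  add_mem' := by
    intro a b ha hb
    simp only [Set.mem_ofPred_eq] at ha hb ⊢
    simp [Finset.sum_add_distrib, ha, hb]
  zero_mem' := by simp
  smul_mem' := by
    intro c a ha
    simp only [Set.mem_ofPred_eq] at ha ⊢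
    simp [← Finset.mul_sum, ha]

/-- The vector `ε_i - ε_j`: a root if `i ≠ j`, a positive root if `i < j`. -/
def root (n : ℕ) (i j : Fin n) : Fin n → ℝ := Pi.single i 1 - Pi.single j 1

/-- The simple root `α_i = ε_i - ε_{i+1}` (in the usual numbering of coordinates from `1`),
for `i = 1, …, n - 1`. -/
def simpleRoot (n : ℕ) [NeZero n] (i : Fin n) : Fin n → ℝ := root n (i - 1) i

/-- The highest root `θ = ε_1 - ε_n` (in the usual numbering of coordinates from `1`). -/
def highestRoot (n : ℕ) [NeZero n] : Fin n → ℝ := root n 0 (-1)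

/-- The hyperplane `⟨v, α⟩ = k` of `V`. -/
def hyperplane (n : ℕ) (α : Fin n → ℝ) (k : ℤ) : Set (V n) := {v | (v : Fin n → ℝ) ⬝ᵥ α = k}

/-- The closed half space `⟨v, α⟩ ≥ k` of `V`. -/
def halfSpaceGE (n : ℕ) (α : Fin n → ℝ) (k : ℤ) : Set (V n) := {v | k ≤ (v : Fin n → ℝ) ⬝ᵥ α}

/-- The closed half space `⟨v, α⟩ ≤ k` of `V`. -/
def halfSpaceLE (n : ℕ) (α : Fin n → ℝ) (k : ℤ) : Set (V n) := {v | (v : Fin n → ℝ) ⬝ᵥ α ≤ k}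

/-- The (closed) dominant chamber. -/
def dominantChamber (n : ℕ) [NeZero n] : Set (V n) :=
  ⋂ (i : Fin n) (_ : i ≠ 0), halfSpaceGE n (simpleRoot n i) 0

/-- The fundamental alcove. -/
def fundamentalAlcove (n : ℕ) [NeZero n] : Set (V n) :=
  interior (halfSpaceLE n (highestRoot n) 1 ∩ dominantChamber n)

/-- `R` is a connected component of the subspace `U`. -/
def IsComponentOf {X : Type*} [TopologicalSpace X] (U R : Set X) : Prop :=
  ∃ x ∈ U, R = connectedComponentIn U x

/-- Alcoves: connected components of the complement of all the hyperplanes `⟨v, α⟩ = k`,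
`α` a positive root and `k` an integer. -/
def IsAlcove (n : ℕ) (A : Set (V n)) : Prop :=
  IsComponentOf (⋃ (i : Fin n) (j : Fin n) (_ : i < j) (k : ℤ), hyperplane n (root n i j) k)ᶜ A

/-- Regions of the `m`-Shi arrangement: connected components of the complement of the
hyperplanes `⟨v, α⟩ = k`, `α` a positive root and `-m < k ≤ m`. -/
def IsShiRegion (n m : ℕ) (R : Set (V n)) : Prop :=
  IsComponentOf (⋃ (i : Fin n) (j : Fin n) (_ : i < j) (k : ℤ) (_ : -(m : ℤ) < k ∧ k ≤ m),
    hyperplane n (root n i j) k)ᶜ R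

/-- Regions of the `m`-Shi arrangement in the dominant chamber. -/
def IsDominantShiRegion (n m : ℕ) [NeZero n] (R : Set (V n)) : Prop :=
  IsShiRegion n m R ∧ R ⊆ dominantChamber n

/-! ### The affine symmetric group, as a group of transformations of `V` -/

/-- The coordinates of `s_i a`: for `i ≠ 0` two adjacent coordinates are exchanged
(the `i`-th and the `(i+1)`-st in the usual numbering from `1`), and
`s_0 (a_1, …, a_n) = (a_n + 1, a_2, …, a_{n-1}, a_1 - 1)`. -/
def reflFun (n : ℕ) [NeZero n] (i : Fin n) (a : Fin n → ℝ) : Fin n → ℝ :=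
  a ∘ Equiv.swap (i - 1) i + if i = 0 then highestRoot n else 0

theorem reflFun_mem (n : ℕ) [NeZero n] (i : Fin n) (a : V n) : reflFun n i a ∈ V n := by
  have ha : ∑ j, (a : Fin n → ℝ) j = 0 := a.2
  change ∑ j, reflFun n i a j = 0
  have h1 : ∑ j, (a : Fin n → ℝ) (Equiv.swap (i - 1) i j) = 0 := by
    rw [Equiv.sum_comp]; exact ha
  unfold reflFun
  split_ifs <;> simp [Finset.sum_add_distrib, h1, highestRoot, root]

theorem reflFun_reflFun (n : ℕ) [NeZero n] (i : Fin n) (a : Fin n → ℝ) :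
    reflFun n i (reflFun n i a) = a := by
  unfold reflFun
  funext j
  by_cases hi : i = 0
  · subst hi
    by_cases h1 : j = 0
    · subst h1
      by_cases h0 : (0 : Fin n) = -1
      · simp [highestRoot, root, ← h0]
      · simp [highestRoot, root, h0, Ne.symm h0]
    · by_cases h2 : j = -1
      · subst h2
        simp [highestRoot, root, h1, Ne.symm h1]
      · have : Equiv.swap (-1) (0 : Fin n) j = j := Equiv.swap_apply_of_ne_of_ne h2 h1
        simp [highestRoot, root, h1, h2, this]
  · simp [hi]

/-- The generator `s_i` as a transformation of `V`. -/
def simpleRefl (n : ℕ) [NeZero n] (i : Fin n) : Equiv.Perm (V n) :=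
  Function.Involutive.toPerm (fun a => ⟨reflFun n i a, reflFun_mem n i a⟩)
    (fun a => Subtype.ext (reflFun_reflFun n i a))

/-- The affine symmetric group: the group of transformations of `V` generated by
`s_0, s_1, …, s_{n-1}`. -/
def affineSymm (n : ℕ) [NeZero n] : Subgroup (Equiv.Perm (V n)) :=
  Subgroup.closure (Set.range (simpleRefl n))

/-- The generator `s_i` as an element of the affine symmetric group. -/
def gen (n : ℕ) [NeZero n] (i : Fin n) : affineSymm n :=
  ⟨simpleRefl n i, Subgroup.subset_closure ⟨i, rfl⟩⟩

/-- The finite symmetric group: the subgroup generated by `s_1, …, s_{n-1}`. -/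
def finiteSymm (n : ℕ) [NeZero n] : Subgroup (affineSymm n) :=
  Subgroup.closure {w | ∃ i : Fin n, i ≠ 0 ∧ w = gen n i}

/-- The length of `w`: the least length of a word in the generators with product `w`. -/
def wordLength (n : ℕ) [NeZero n] (w : affineSymm n) : ℕ :=
  sInf {k | ∃ l : List (Fin n), l.length = k ∧ (l.map (gen n)).prod = w}

/-- `w` has minimal length in its left coset of the finite symmetric group. -/
def IsMinLeftCosetRep (n : ℕ) [NeZero n] (w : affineSymm n) : Prop :=
  ∀ u ∈ finiteSymm n, wordLength n w ≤ wordLength n (w * u)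

/-- The alcove `w A₀`. -/
def alcove (n : ℕ) [NeZero n] (w : affineSymm n) : Set (V n) :=
  (w : Equiv.Perm (V n)) '' fundamentalAlcove n

/-- `A = w A₀` is `m`-minimal: `w` has smallest length among the alcoves `w' A₀` contained in
the same region of the `m`-Shi arrangement. -/
def IsMMinimal (n m : ℕ) [NeZero n] (A : Set (V n)) : Prop :=
  ∃ R, IsShiRegion n m R ∧ ∃ w : affineSymm n, A = alcove n w ∧ A ⊆ R ∧
    ∀ w' : affineSymm n, alcove n w' ⊆ R → wordLength n w ≤ wordLength n w'

/-! ### Partitions and cores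

Partitions are identified with their Young diagrams; a box is `(row, column)`. -/

/-- The hook length of the box `c`: one plus the number of boxes to its right in its row plus
the number of boxes below it in its column. -/
def hookLength (μ : YoungDiagram) (c : ℕ × ℕ) : ℕ :=
  1 + (μ.rowLen c.1 - (c.2 + 1)) + (μ.colLen c.2 - (c.1 + 1))

/-- `μ` is a `t`-core: no hook length of `μ` is divisible by `t`. -/
def IsCore (t : ℕ) (μ : YoungDiagram) : Prop := ∀ c ∈ μ, ¬ t ∣ hookLength μ c

/-- The set of `n`-cores. -/
abbrev Core (n : ℕ) : Type := {μ : YoungDiagram // IsCore n μ}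

/-- The empty partition. -/
def emptyCore (n : ℕ) : Core n := ⟨⊥, fun c hc => absurd hc (YoungDiagram.notMem_bot c)⟩

/-- The residue of a box. -/
def residue (n : ℕ) (c : ℕ × ℕ) : ZMod n := (c.2 : ZMod n) - (c.1 : ZMod n)

/-- The addable boxes of residue `i`. -/
def addable (n : ℕ) (i : Fin n) (μ : YoungDiagram) : Set (ℕ × ℕ) :=
  {c | c ∉ μ ∧ IsLowerSet (insert c (μ : Set (ℕ × ℕ))) ∧ residue n c = ((i : ℕ) : ZMod n)}

/-- The removable boxes of residue `i`. -/
def removable (n : ℕ) (i : Fin n) (μ : YoungDiagram) : Set (ℕ × ℕ) :=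
  {c | c ∈ μ ∧ IsLowerSet ((μ : Set (ℕ × ℕ)) \ {c}) ∧ residue n c = ((i : ℕ) : ZMod n)}

open Classical in
/-- The boxes of `s_i μ`: all addable boxes of residue `i` are added if there are any; otherwise
all removable boxes of residue `i` are removed if there are any; otherwise nothing changes. -/
def moveBoxes (n : ℕ) (i : Fin n) (μ : YoungDiagram) : Set (ℕ × ℕ) :=
  if (addable n i μ).Nonempty then (μ : Set (ℕ × ℕ)) ∪ addable n i μ
  else if (removable n i μ).Nonempty then (μ : Set (ℕ × ℕ)) \ removable n i μ
  else (μ : Set (ℕ × ℕ))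

end ShiCore

end

open ShiCore

/-!
# Cores, dominant alcoves and the `m`-Shi arrangement

Everything is compared with the lattice vectors `c = w 0`.

*Geometry.* A vector is studied through the integer parts of its differences of coordinates. A wall
of the fundamental alcove that separates it from a generic vector `v` gives a generator which moves
`v` one hyperplane closer (`gapSum_reflFun`). Hence galleries exist (`exists_word`), the affine
symmetric group is simply transitive on the alcoves (`isAlcove_iff`, `alcove_injective`), and the
length of `w` is the number of hyperplanes between `A₀` and `w A₀` (`two_mul_wordLength`). Finite
permutations sort the coordinates, so `w` is minimal in its coset exactly when `w⁻¹ A₀` is dominant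
(`isMinLeftCosetRep_iff`), and such a `w` is determined by `w 0`, which can be any lattice vector.

*Cores.* A partition is encoded by its bead set. Hook lengths are the distances from a bead down to
an empty position, so that a core fills each of `n` runners up to some level (`isCore_iff`,
`isBead_iff_lt_coreVec`); the levels form a lattice vector of sum zero. Moving boxes of residue `i`
exchanges two neighbouring runners, which is the action of `s_i` on that vector (`coreVec_move`).
Thus cores embed equivariantly into the lattice vectors; since `∅` goes to `0` and the group is
transitive on the lattice, this is a bijection, and `Φ` is obtained by matching both sides through
`c = w 0`.

*Minimality.* An `n`-core is an `(m n + 1)`-core if and only if its vector `c` satisfies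
`⟨c, α_i⟩ ≥ -m` and `⟨c, θ⟩ ≤ m + 1` (`isCore_iff_inDilate`). The same inequalities say that each
wall of the dominant alcove `w⁻¹ A₀` that separates it from `A₀` is a hyperplane of the `m`-Shi
arrangement. If one fails, the neighbour across that wall is shorter and in the same region
(`exists_shorter`). If all hold, consider a positive root with the largest level at which one of
its hyperplanes separates the alcove from `A₀`: both are sums, over the same pieces, of roots and
levels of separating Shi hyperplanes, with levels between `1` and `m` (`le_sub_of_steps`). So every
other point of the region is separated from `A₀` at that level as well (`floor_le_of_inDilate`),
which makes the alcove the unique shortest one of its region.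
-/

open ShiCore

namespace ShiCore

/-! ### Coordinates of the generators -/

theorem val_neg_one (n : ℕ) [NeZero n] : ((-1 : Fin n) : ℕ) = n - 1 := by
  obtain ⟨k, rfl⟩ := Nat.exists_eq_succ_of_ne_zero (NeZero.ne n)
  simp

theorem val_pred {n : ℕ} [NeZero n] (i : Fin n) :
    ((i - 1 : Fin n) : ℕ) = if i = 0 then n - 1 else (i : ℕ) - 1 := by
  split_ifs with h
  · rw [h, zero_sub, val_neg_one]
  · exact Fin.val_sub_one_of_ne_zero h

theorem pred_ne {n : ℕ} [NeZero n] (hn : 2 ≤ n) (i : Fin n) : i - 1 ≠ i := by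
  intro h
  have h1 := val_pred i
  rw [h] at h1
  split_ifs at h1 with h0
  · rw [h0] at h1; simp at h1; omega
  · have : (i : ℕ) ≠ 0 := fun h => h0 (Fin.ext h)
    omega

/-- The shift `δ_i` made by `s_i`: it is `1` for the affine generator `s_0` and `0` otherwise. -/
def shift {n : ℕ} [NeZero n] (i : Fin n) : ℤ := if i = 0 then 1 else 0

theorem reflFun_apply {n : ℕ} [NeZero n] (hn : 2 ≤ n) (i : Fin n) (a : Fin n → ℝ) (j : Fin n) :
    reflFun n i a j = a (Equiv.swap (i - 1) i j) +
      ((if j = i then shift i else if j = i - 1 then - shift i else 0 : ℤ) : ℝ) := by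
  have h01 : (0 : Fin n) ≠ -1 := fun h => pred_ne hn 0 (by rw [zero_sub, ← h])
  unfold reflFun shift
  by_cases hi : i = 0
  · subst hi
    by_cases h1 : j = 0
    · subst h1; simp [highestRoot, root, h01]
    · by_cases h2 : j = -1
      · subst h2; simp [highestRoot, root, h1]
      · simp [highestRoot, root, h1, h2]
  · simp [hi]

/-! ### Generic vectors and the sum of their gaps -/

/-- No difference of two coordinates is an integer: the vector lies on no hyperplane. -/
def IsGeneric {n : ℕ} (v : Fin n → ℝ) : Prop :=
  ∀ i j, i ≠ j → ∀ k : ℤ, v i - v j ≠ k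

/-- The inequalities that define the fundamental alcove. -/
def InBase {n : ℕ} (v : Fin n → ℝ) : Prop :=
  ∀ i j, i < j → 0 < v i - v j ∧ v i - v j < 1

theorem InBase.isGeneric {n : ℕ} {v : Fin n → ℝ} (hv : InBase v) : IsGeneric v := by
  intro i j hij k hk
  rcases lt_or_gt_of_ne hij with h | h
  · obtain ⟨h1, h2⟩ := hv i j h
    rw [hk] at h1 h2
    have h1 : 0 < k := by exact_mod_cast h1
    have h2 : k < 1 := by exact_mod_cast h2
    omega
  · obtain ⟨h1, h2⟩ := hv j i h
    rw [← neg_sub, hk] at h1 h2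
    have h1 : 0 < -k := by exact_mod_cast h1
    have h2 : -k < 1 := by exact_mod_cast h2
    omega

theorem InBase.floor_eq {n : ℕ} {v : Fin n → ℝ} (hv : InBase v) {i j : Fin n} (hij : i < j) :
    ⌊v i - v j⌋ = 0 := by
  rw [Int.floor_eq_zero_iff]
  exact ⟨(hv i j hij).1.le, (hv i j hij).2⟩

theorem IsGeneric.floor_swap {n : ℕ} {v : Fin n → ℝ} (hv : IsGeneric v) {i j : Fin n}
    (hij : i ≠ j) : ⌊v j - v i⌋ = -⌊v i - v j⌋ - 1 := by
  rw [Int.floor_eq_iff]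
  have h1 := Int.floor_le (v i - v j)
  have h2 := Int.lt_floor_add_one (v i - v j)
  have h3 := lt_of_le_of_ne h1 (fun h => hv i j hij _ h.symm)
  push_cast
  constructor <;> linarith

theorem isGeneric_affine {n : ℕ} {v : Fin n → ℝ} (hv : IsGeneric v) (σ : Equiv.Perm (Fin n))
    (z : Fin n → ℤ) : IsGeneric fun j => v (σ j) + z j := by
  intro i j hij k hk
  refine hv (σ i) (σ j) (fun h => hij (σ.injective h)) (k - z i + z j) ?_
  push_cast
  linarith

theorem floor_affine {n : ℕ} (v : Fin n → ℝ) (σ : Equiv.Perm (Fin n)) (z : Fin n → ℤ)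
    (i j : Fin n) :
    ⌊(v (σ i) + z i) - (v (σ j) + z j)⌋ = ⌊v (σ i) - v (σ j)⌋ + (z i - z j) := by
  rw [← Int.floor_add_intCast]
  congr 1
  push_cast
  ring

/-- The number of hyperplanes `⟨·, ε_a - ε_b⟩ = k`, up to sign, that separate `v` from the
fundamental alcove: the gap is taken along the positive one of the two roots `± (ε_a - ε_b)`. -/
noncomputable def gap {n : ℕ} (v : Fin n → ℝ) (a b : Fin n) : ℤ :=
  if a < b then |⌊v a - v b⌋| else if b < a then |⌊v b - v a⌋| else 0

theorem gap_comm {n : ℕ} (v : Fin n → ℝ) (a b : Fin n) : gap v a b = gap v b a := by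
  unfold gap
  rcases lt_trichotomy a b with h | h | h
  · simp [h, h.not_gt]
  · simp [h]
  · simp [h, h.not_gt]

/-- The sum of the gaps over all ordered pairs, hence twice the number of hyperplanes that separate
`v` from the fundamental alcove. -/
noncomputable def gapSum {n : ℕ} (v : Fin n → ℝ) : ℤ := ∑ x : Fin n × Fin n, gap v x.1 x.2

theorem gap_nonneg {n : ℕ} (v : Fin n → ℝ) (a b : Fin n) : 0 ≤ gap v a b := by
  unfold gap
  split_ifs <;> positivity

theorem gapSum_nonneg {n : ℕ} (v : Fin n → ℝ) : 0 ≤ gapSum v :=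
  Finset.sum_nonneg fun x _ => gap_nonneg v x.1 x.2

theorem gapSum_of_inBase {n : ℕ} {v : Fin n → ℝ} (hv : InBase v) : gapSum v = 0 := by
  refine Finset.sum_eq_zero fun x _ => ?_
  unfold gap
  split_ifs with h1 h2
  · simp [hv.floor_eq h1]
  · simp [hv.floor_eq h2]
  · rfl

theorem isGeneric_reflFun {n : ℕ} [NeZero n] (hn : 2 ≤ n) (i : Fin n) {v : Fin n → ℝ}
    (hv : IsGeneric v) : IsGeneric (reflFun n i v) := by
  have := isGeneric_affine hv (Equiv.swap (i - 1) i)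
    (fun j => if j = i then shift i else if j = i - 1 then - shift i else 0)
  convert this using 1
  funext j
  exact reflFun_apply hn i v j

/-- Apart from the hyperplanes of one direction, `s_i` permutes the hyperplanes that separate a
point from the fundamental alcove. -/
theorem gap_reflFun {n : ℕ} [NeZero n] (hn : 2 ≤ n) (i : Fin n) {v : Fin n → ℝ}
    (hv : IsGeneric v) (a b : Fin n) (h1 : ¬ (a = i - 1 ∧ b = i)) (h2 : ¬ (a = i ∧ b = i - 1)) :
    gap (reflFun n i v) a b = gap v (Equiv.swap (i - 1) i a) (Equiv.swap (i - 1) i b) := by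
  -- by symmetry it is enough to treat `a < b`
  suffices H : ∀ a b : Fin n, a < b → ¬ (a = i - 1 ∧ b = i) → ¬ (a = i ∧ b = i - 1) →
      gap (reflFun n i v) a b = gap v (Equiv.swap (i - 1) i a) (Equiv.swap (i - 1) i b) by
    rcases lt_trichotomy a b with h | h | h
    · exact H a b h h1 h2
    · subst h; simp [gap]
    · rw [gap_comm, gap_comm v]
      exact H b a h (fun h => h2 ⟨h.2, h.1⟩) (fun h => h1 ⟨h.2, h.1⟩)
  clear h1 h2 a b
  intro a b hab h1 h2
  have hp := val_pred i
  have hne := pred_ne hn i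
  have ha := a.2
  have hb := b.2
  have hin := i.2
  have hab' : (a : ℕ) < b := hab
  rw [gap, if_pos hab, reflFun_apply hn, reflFun_apply hn]
  have fl : ∀ (x : ℝ) (k : ℤ), ⌊x + k⌋ = ⌊x⌋ + k := fun x k => Int.floor_add_intCast x k
  by_cases hi : i = 0
  · have hs : shift i = 1 := by simp [shift, hi]
    rw [if_pos hi] at hp
    have hi0 : (i : ℕ) = 0 := by rw [hi]; rfl
    have hbi : b ≠ i := by rintro rfl; omega
    have hai : a ≠ i - 1 := by intro h; have := congrArg Fin.val h; omega
    rw [if_neg hbi, if_neg hai, hs]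
    by_cases ha' : a = i
    · have hb' : b ≠ i - 1 := fun h => h2 ⟨ha', h⟩
      have hlt : b < i - 1 := by
        rw [Fin.lt_def]; have : (b : ℕ) ≠ (i - 1 : Fin n) := fun h => hb' (Fin.ext h); omega
      rw [if_pos ha', if_neg hb', ha', Equiv.swap_apply_right,
        Equiv.swap_apply_of_ne_of_ne hb' hbi, gap, if_neg hlt.not_gt, if_pos hlt]
      have : v (i - 1) + ((1 : ℤ) : ℝ) - (v b + ((0 : ℤ) : ℝ)) =
        (v (i - 1) - v b) + ((1 : ℤ) : ℝ) := by push_cast; ring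
      rw [this, fl, hv.floor_swap hb', ← abs_neg]
      congr 1
      ring
    · rw [if_neg ha', Equiv.swap_apply_of_ne_of_ne hai ha']
      by_cases hb' : b = i - 1
      · have hlt : i < a := by
          rw [Fin.lt_def]; have : (a : ℕ) ≠ i := fun h => ha' (Fin.ext h); omega
        rw [if_pos hb', hb', Equiv.swap_apply_left, gap, if_neg hlt.not_gt, if_pos hlt]
        have : v a + ((0 : ℤ) : ℝ) - (v i + ((-1 : ℤ) : ℝ)) =
          (v a - v i) + ((1 : ℤ) : ℝ) := by push_cast; ring
        rw [this, fl, hv.floor_swap (Ne.symm ha'), ← abs_neg]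
        congr 1
        ring
      · rw [if_neg hb', Equiv.swap_apply_of_ne_of_ne hb' hbi, gap, if_pos hab]
        simp
  · have hs : shift i = 0 := by simp [shift, hi]
    rw [if_neg hi] at hp
    have hi0 : (i : ℕ) ≠ 0 := fun h => hi (Fin.ext h)
    have hlt : Equiv.swap (i - 1) i a < Equiv.swap (i - 1) i b := by
      rw [Fin.lt_def]
      simp only [Equiv.swap_apply_def, Fin.ext_iff] at h1 h2 ⊢
      split_ifs <;> omega
    rw [gap, if_pos hlt, hs]
    simp

/-- A reflection in a wall of the fundamental alcove that separates it from `v` moves `v` one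
hyperplane closer. -/
theorem gapSum_reflFun {n : ℕ} [NeZero n] (hn : 2 ≤ n) (i : Fin n) {v : Fin n → ℝ}
    (hv : IsGeneric v) (hd : v (i - 1) - v i + shift i < 0) :
    gapSum v = gapSum (reflFun n i v) + 2 := by
  have hne := pred_ne hn i
  have key : ∀ x : Fin n × Fin n,
      gap v (Equiv.swap (i - 1) i x.1) (Equiv.swap (i - 1) i x.2) - gap (reflFun n i v) x.1 x.2 =
      (if x = (i - 1, i) then 1 else 0) + (if x = (i, i - 1) then 1 else 0) := by
    have H : gap v (i - 1) i - gap (reflFun n i v) (i - 1) i = 1 := by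
      have hp := val_pred i
      have hin := i.2
      have e1 : reflFun n i v i = v (i - 1) + (shift i : ℝ) := by
        rw [reflFun_apply hn]; simp
      have e2 : reflFun n i v (i - 1) = v i - (shift i : ℝ) := by
        rw [reflFun_apply hn]; simp [hne]; ring
      by_cases hi : i = 0
      · have hs : shift i = 1 := by simp [shift, hi]
        rw [if_pos hi] at hp
        have hi0 : (i : ℕ) = 0 := by rw [hi]; rfl
        have hlt : i < i - 1 := by rw [Fin.lt_def]; omega
        rw [gap, gap, if_neg hlt.not_gt, if_pos hlt, if_neg hlt.not_gt, if_pos hlt, e1, e2, hs]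
        have : v (i - 1) + ((1 : ℤ) : ℝ) - (v i - ((1 : ℤ) : ℝ)) =
          (v (i - 1) - v i) + ((2 : ℤ) : ℝ) := by push_cast; ring
        rw [this, Int.floor_add_intCast, hv.floor_swap hne.symm]
        have : 1 ≤ ⌊v i - v (i - 1)⌋ := by
          rw [Int.le_floor]; rw [hs] at hd; push_cast at hd ⊢; linarith
        rw [abs_of_nonneg (by omega), abs_of_nonpos (by omega)]
        ring
      · have hs : shift i = 0 := by simp [shift, hi]
        rw [if_neg hi] at hp
        have hi0 : (i : ℕ) ≠ 0 := fun h => hi (Fin.ext h)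
        have hlt : i - 1 < i := by rw [Fin.lt_def]; omega
        rw [gap, gap, if_pos hlt, if_pos hlt, e1, e2, hs]
        have : v i - ((0 : ℤ) : ℝ) - (v (i - 1) + ((0 : ℤ) : ℝ)) = v i - v (i - 1) := by
          push_cast; ring
        rw [this, hv.floor_swap hne]
        have : ⌊v (i - 1) - v i⌋ < 0 := by
          rw [Int.floor_lt]; rw [hs] at hd; push_cast at hd ⊢; linarith
        rw [abs_of_neg this, abs_of_nonneg (by omega)]
        ring
    rintro ⟨a, b⟩
    by_cases h1 : a = i - 1 ∧ b = i
    · obtain ⟨rfl, rfl⟩ := h1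
      rw [Equiv.swap_apply_left, Equiv.swap_apply_right, gap_comm v, H]
      simp [hne]
    · by_cases h2 : a = i ∧ b = i - 1
      · obtain ⟨rfl, rfl⟩ := h2
        rw [Equiv.swap_apply_left, Equiv.swap_apply_right, gap_comm (reflFun n a v), H]
        simp [hne]
      · have h1' : ¬ ((a, b) = (i - 1, i)) := fun h => h1 (Prod.ext_iff.mp h)
        have h2' : ¬ ((a, b) = (i, i - 1)) := fun h => h2 (Prod.ext_iff.mp h)
        rw [if_neg h1', if_neg h2', gap_reflFun hn i hv a b h1 h2]
        simp
  have hsum : gapSum v = ∑ x : Fin n × Fin n,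
      gap v (Equiv.swap (i - 1) i x.1) (Equiv.swap (i - 1) i x.2) :=
    (Equiv.sum_comp ((Equiv.swap (i - 1) i).prodCongr (Equiv.swap (i - 1) i))
      (fun x : Fin n × Fin n => gap v x.1 x.2)).symm
  have h2 : gapSum v - gapSum (reflFun n i v) = 2 := by
    rw [hsum, gapSum, ← Finset.sum_sub_distrib, Finset.sum_congr rfl fun x _ => key x,
      Finset.sum_add_distrib, Finset.sum_ite_eq', Finset.sum_ite_eq']
    simp
  omega

theorem gapSum_reflFun_le {n : ℕ} [NeZero n] (hn : 2 ≤ n) (i : Fin n) {v : Fin n → ℝ}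
    (hv : IsGeneric v) : gapSum (reflFun n i v) ≤ gapSum v + 2 := by
  have hne := pred_ne hn i
  by_cases hd : v (i - 1) - v i + shift i < 0
  · have := gapSum_reflFun hn i hv hd; omega
  · -- `s_i v` lies on the far side of the wall
    have hg := isGeneric_reflFun hn i hv
    have h0 : v (i - 1) - v i + shift i ≠ 0 := fun h =>
      hv (i - 1) i hne (- shift i) (by push_cast; linarith)
    have e1 : reflFun n i v i = v (i - 1) + (shift i : ℝ) := by
      rw [reflFun_apply hn]; simp
    have e2 : reflFun n i v (i - 1) = v i - (shift i : ℝ) := by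
      rw [reflFun_apply hn]; simp [hne]; ring
    have := gapSum_reflFun hn i hg (by
      rw [e1, e2]; have := lt_of_le_of_ne (not_lt.mp hd) h0.symm; linarith)
    rw [reflFun_reflFun] at this
    omega

/-! ### Elements of the affine symmetric group -/

theorem sum_coe {n : ℕ} (v : V n) : ∑ i, (v : Fin n → ℝ) i = 0 := v.2

theorem V_ext {n : ℕ} {v v' : V n} (h : ∀ j, (v : Fin n → ℝ) j = (v' : Fin n → ℝ) j) : v = v' :=
  Subtype.ext (funext h)

theorem gen_apply {n : ℕ} [NeZero n] (i : Fin n) (v : V n) :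
    (((gen n i).1 v : V n) : Fin n → ℝ) = reflFun n i v := rfl

theorem gen_mul_self {n : ℕ} [NeZero n] (i : Fin n) : gen n i * gen n i = 1 :=
  Subtype.ext (Equiv.ext fun v => Subtype.ext (reflFun_reflFun n i v))

theorem gen_inv {n : ℕ} [NeZero n] (i : Fin n) : (gen n i)⁻¹ = gen n i :=
  inv_eq_of_mul_eq_one_left (gen_mul_self i)

theorem mul_apply {n : ℕ} [NeZero n] (w w' : affineSymm n) (v : V n) :
    (w * w').1 v = w.1 (w'.1 v) := rfl

theorem inv_apply_self {n : ℕ} [NeZero n] (w : affineSymm n) (v : V n) : w⁻¹.1 (w.1 v) = v := by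
  rw [← mul_apply, inv_mul_cancel]; rfl

theorem apply_inv_self {n : ℕ} [NeZero n] (w : affineSymm n) (v : V n) : w.1 (w⁻¹.1 v) = v := by
  rw [← mul_apply, mul_inv_cancel]; rfl

theorem affineSymm_induction {n : ℕ} [NeZero n] {P : affineSymm n → Prop} (one : P 1)
    (gen_mul : ∀ i w, P w → P (gen n i * w)) (w : affineSymm n) : P w := by
  obtain ⟨w, hw⟩ := w
  induction hw using Subgroup.closure_induction_left with
  | one => exact one
  | mul_left x hx y hy ih =>
    obtain ⟨i, rfl⟩ := hx
    exact gen_mul i _ ih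
  | inv_mul_cancel x hx y hy ih =>
    obtain ⟨i, rfl⟩ := hx
    have := gen_mul i _ ih
    rw [← gen_inv] at this
    exact this

/-- Elements of the affine symmetric group permute the coordinates and add integers to them. -/
theorem exists_perm {n : ℕ} [NeZero n] (hn : 2 ≤ n) (w : affineSymm n) :
    ∃ (σ : Equiv.Perm (Fin n)) (z : Fin n → ℤ), ∀ (v : V n) (j : Fin n),
      ((w.1 v : V n) : Fin n → ℝ) j = (v : Fin n → ℝ) (σ j) + z j := by
  induction w using affineSymm_induction with
  | one => exact ⟨1, 0, fun v j => by simp⟩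
  | gen_mul i w ih =>
    obtain ⟨σ, z, h⟩ := ih
    refine ⟨(Equiv.swap (i - 1) i).trans σ, fun j => z (Equiv.swap (i - 1) i j) +
      (if j = i then shift i else if j = i - 1 then - shift i else 0), fun v j => ?_⟩
    rw [mul_apply, gen_apply, reflFun_apply hn, h]
    simp only [Equiv.trans_apply]
    push_cast
    ring

theorem finiteSymm_induction {n : ℕ} [NeZero n] {P : affineSymm n → Prop} (one : P 1)
    (gen_mul : ∀ i w, i ≠ 0 → P w → P (gen n i * w)) {w : affineSymm n} (hw : w ∈ finiteSymm n) :
    P w := by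
  induction hw using Subgroup.closure_induction_left with
  | one => exact one
  | mul_left x hx y hy ih =>
    obtain ⟨i, hi, rfl⟩ := hx
    exact gen_mul i _ hi ih
  | inv_mul_cancel x hx y hy ih =>
    obtain ⟨i, hi, rfl⟩ := hx
    rw [gen_inv]
    exact gen_mul i _ hi ih

theorem gen_mem_finiteSymm {n : ℕ} [NeZero n] {i : Fin n} (hi : i ≠ 0) : gen n i ∈ finiteSymm n :=
  Subgroup.subset_closure ⟨i, hi, rfl⟩

theorem exists_perm_of_apply_zero {n : ℕ} [NeZero n] (hn : 2 ≤ n) {w : affineSymm n}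
    (hw : w.1 0 = 0) : ∃ σ : Equiv.Perm (Fin n), ∀ (v : V n) (j : Fin n),
      ((w.1 v : V n) : Fin n → ℝ) j = (v : Fin n → ℝ) (σ j) := by
  obtain ⟨σ, z, h⟩ := exists_perm hn w
  refine ⟨σ, fun v j => ?_⟩
  have h0 := h 0 j
  rw [hw] at h0
  rw [h v j]
  have : (z j : ℝ) = 0 := by simpa using h0.symm
  rw [this, add_zero]

theorem finiteSymm_apply_zero {n : ℕ} [NeZero n] (hn : 2 ≤ n) {u : affineSymm n}
    (hu : u ∈ finiteSymm n) : u.1 0 = 0 := by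
  refine finiteSymm_induction (P := fun u => u.1 0 = 0) rfl (fun i w hi hw => ?_) hu
  rw [mul_apply, hw]
  refine V_ext fun j => ?_
  rw [gen_apply, reflFun_apply hn]
  simp [shift, hi]

theorem isGeneric_apply {n : ℕ} [NeZero n] (hn : 2 ≤ n) (w : affineSymm n) {v : V n}
    (hv : IsGeneric (v : Fin n → ℝ)) : IsGeneric ((w.1 v : V n) : Fin n → ℝ) := by
  obtain ⟨σ, z, h⟩ := exists_perm hn w
  rw [funext (h v)]
  exact isGeneric_affine hv σ z

/-! ### Simple transitivity -/

/-- A fixed point of the fundamental alcove. -/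
theorem exists_inBase (n : ℕ) : ∃ p : V n, InBase (p : Fin n → ℝ) := by
  rcases Nat.eq_zero_or_pos n with rfl | hn
  · exact ⟨0, fun i => i.elim0⟩
  have hn' : (0 : ℝ) < n := by exact_mod_cast hn
  set s : ℝ := (∑ i : Fin n, ((i : ℕ) : ℝ)) / n with hs
  refine ⟨⟨fun i => (s - ((i : ℕ) : ℝ)) / n, ?_⟩, fun i j hij => ?_⟩
  · change ∑ i : Fin n, (s - ((i : ℕ) : ℝ)) / n = 0
    rw [← Finset.sum_div, Finset.sum_sub_distrib, Finset.sum_const, Finset.card_univ,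
      Fintype.card_fin, nsmul_eq_mul, hs, mul_div_cancel₀ _ hn'.ne', sub_self, zero_div]
  · have h1 : ((i : ℕ) : ℝ) < ((j : ℕ) : ℝ) := by exact_mod_cast hij
    have h2 : ((j : ℕ) : ℝ) < n := by exact_mod_cast j.2
    have h3 : (0 : ℝ) ≤ ((i : ℕ) : ℝ) := by positivity
    have : (s - ((i : ℕ) : ℝ)) / n - (s - ((j : ℕ) : ℝ)) / n =
        (((j : ℕ) : ℝ) - ((i : ℕ) : ℝ)) / n := by ring
    change 0 < (s - ((i : ℕ) : ℝ)) / n - (s - ((j : ℕ) : ℝ)) / n ∧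
      (s - ((i : ℕ) : ℝ)) / n - (s - ((j : ℕ) : ℝ)) / n < 1
    rw [this, div_lt_one hn']
    exact ⟨div_pos (by linarith) hn', by linarith⟩

/-- A permutation that keeps a strictly decreasing vector strictly decreasing is trivial. -/
theorem perm_eq_one_of_strictAnti {n : ℕ} {v : Fin n → ℝ} {σ : Equiv.Perm (Fin n)}
    (h1 : StrictAnti v) (h2 : StrictAnti (v ∘ σ)) : σ = 1 := by
  have hσ : StrictMono σ := fun i j hij => h1.lt_iff_gt.mp (h2 hij)
  have : Set.range σ = Set.range (id : Fin n → Fin n) := by simp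
  exact Equiv.ext fun i => congrFun ((StrictMono.range_inj hσ strictMono_id).mp this) i

theorem InBase.strictAnti {n : ℕ} {v : Fin n → ℝ} (hv : InBase v) : StrictAnti v :=
  fun i j hij => by linarith [(hv i j hij).1]

theorem InBase.abs_lt {n : ℕ} {v : Fin n → ℝ} (hv : InBase v) (i j : Fin n) :
    |v i - v j| < 1 := by
  rw [_root_.abs_lt]
  rcases lt_trichotomy i j with h | h | h
  · have := hv i j h; constructor <;> linarith
  · subst h; simp
  · have := hv j i h; constructor <;> linarith

/-- An affine permutation that maps a point of the fundamental alcove into the fundamental alcove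
is trivial. -/
theorem eq_one_of_inBase {n : ℕ} {p q : V n} (hp : InBase (p : Fin n → ℝ))
    (hq : InBase (q : Fin n → ℝ)) {σ : Equiv.Perm (Fin n)} {z : Fin n → ℤ}
    (h : ∀ j, (q : Fin n → ℝ) j = (p : Fin n → ℝ) (σ j) + z j) : σ = 1 ∧ z = 0 := by
  have hz : ∀ i j, z i - z j ≤ 1 := by
    intro i j
    have h1 := abs_lt.mp (hq.abs_lt i j)
    have h2 := abs_lt.mp (hp.abs_lt (σ i) (σ j))
    have h3 : ((z i - z j : ℤ) : ℝ) < 2 := by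
      push_cast
      linarith [h i, h j]
    have : z i - z j < 2 := by exact_mod_cast h3
    omega
  have hsum : ∑ j, z j = 0 := by
    have h1 := sum_coe q
    rw [Finset.sum_congr rfl fun j _ => h j, Finset.sum_add_distrib, Equiv.sum_comp,
      sum_coe p, zero_add] at h1
    exact_mod_cast h1
  have hz0 : z = 0 := by
    funext i
    by_contra hi
    rcases lt_or_gt_of_ne hi with hi | hi
    · have : ∑ j, z j < ∑ _j : Fin n, (0 : ℤ) := by
        refine Finset.sum_lt_sum (fun j _ => ?_) ⟨i, Finset.mem_univ i, hi⟩
        have := hz j i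
        simp only [Pi.zero_apply] at hi
        omega
      simp [hsum] at this
    · have : ∑ _j : Fin n, (0 : ℤ) < ∑ j, z j := by
        refine Finset.sum_lt_sum (fun j _ => ?_) ⟨i, Finset.mem_univ i, hi⟩
        have := hz i j
        simp only [Pi.zero_apply] at hi
        omega
      simp [hsum] at this
  refine ⟨perm_eq_one_of_strictAnti hp.strictAnti ?_, hz0⟩
  intro i j hij
  have := hq.strictAnti hij
  rw [h i, h j, hz0] at this
  simpa using this

theorem eq_one_of_inBase_apply {n : ℕ} [NeZero n] (hn : 2 ≤ n) {w : affineSymm n} {p : V n}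
    (hp : InBase (p : Fin n → ℝ)) (hq : InBase ((w.1 p : V n) : Fin n → ℝ)) : w = 1 := by
  obtain ⟨σ, z, h⟩ := exists_perm hn w
  obtain ⟨rfl, rfl⟩ := eq_one_of_inBase hp hq (h p)
  refine Subtype.ext (Equiv.ext fun v => V_ext fun j => ?_)
  rw [h v j]
  simp

/-! ### Word length -/

theorem strictAnti_of_pred {n : ℕ} [NeZero n] {v : Fin n → ℝ}
    (h : ∀ i : Fin n, i ≠ 0 → v i < v (i - 1)) : StrictAnti v := by
  intro i j hij
  obtain ⟨j, hj⟩ := j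
  induction j with
  | zero => exact absurd hij (by simp)
  | succ j ih =>
    have hj0 : (⟨j + 1, hj⟩ : Fin n) ≠ 0 := fun h => by
      have := congrArg Fin.val h; simp at this
    have hp : (⟨j + 1, hj⟩ - 1 : Fin n) = ⟨j, by omega⟩ := by
      apply Fin.ext; rw [val_pred, if_neg hj0]; simp
    have h1 := h _ hj0
    rw [hp] at h1
    rcases Nat.lt_succ_iff_lt_or_eq.mp (show (i : ℕ) < j + 1 from hij) with h2 | h2
    · exact h1.trans (ih (by omega) h2)
    · have : i = ⟨j, by omega⟩ := Fin.ext h2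
      rw [this]; exact h1

/-- A vector on the inner side of every wall of the fundamental alcove lies in it. -/
theorem inBase_of_walls {n : ℕ} [NeZero n] {v : Fin n → ℝ}
    (h : ∀ i : Fin n, 0 < v (i - 1) - v i + shift i) : InBase v := by
  have hs : StrictAnti v := strictAnti_of_pred fun i hi => by
    have := h i; simp [shift, hi] at this; linarith
  intro i j hij
  refine ⟨by linarith [hs hij], ?_⟩
  have h0 := h 0
  have h1 : v i ≤ v 0 := hs.antitone (Fin.zero_le i)
  have h2 : v (0 - 1) ≤ v j := hs.antitone (by
    rw [Fin.le_def, val_pred, if_pos rfl]; have := j.2; omega)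
  simp [shift] at h0 h2
  linarith

/-- Galleries: a generic vector is moved into the fundamental alcove by as many generators as there
are hyperplanes in between. -/
theorem exists_word {n : ℕ} [NeZero n] (hn : 2 ≤ n) (v : V n) (hv : IsGeneric (v : Fin n → ℝ)) :
    ∃ l : List (Fin n), 2 * (l.length : ℤ) = gapSum (v : Fin n → ℝ) ∧
      InBase (((l.map (gen n)).prod.1 v : V n) : Fin n → ℝ) := by
  induction hN : (gapSum (v : Fin n → ℝ)).toNat using Nat.strong_induction_on generalizing v with
  | _ N ih =>
    by_cases hw : ∀ i : Fin n, 0 < (v : Fin n → ℝ) (i - 1) - (v : Fin n → ℝ) i + shift i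
    · have hb := inBase_of_walls hw
      exact ⟨[], by simp [gapSum_of_inBase hb], hb⟩
    · push Not at hw
      obtain ⟨i, hi⟩ := hw
      have h0 : (v : Fin n → ℝ) (i - 1) - (v : Fin n → ℝ) i + shift i ≠ 0 := fun h =>
        hv (i - 1) i (pred_ne hn i) (- shift i) (by push_cast; linarith)
      have h1 := gapSum_reflFun hn i hv (lt_of_le_of_ne hi h0)
      have hg := isGeneric_reflFun hn i hv
      have hnn := gapSum_nonneg (reflFun n i v)
      obtain ⟨l, hl, hb⟩ := ih (gapSum (reflFun n i v)).toNat (by omega) ((gen n i).1 v) hg rfl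
      refine ⟨l ++ [i], ?_, ?_⟩
      · rw [h1, ← gen_apply, ← hl]; push_cast [List.length_append, List.length_singleton]; ring
      · rw [List.map_append, List.prod_append, mul_apply]
        simpa using hb

theorem gapSum_word_le {n : ℕ} [NeZero n] (hn : 2 ≤ n) (l : List (Fin n)) (v : V n)
    (hv : IsGeneric (v : Fin n → ℝ)) :
    gapSum (((l.map (gen n)).prod.1 v : V n) : Fin n → ℝ) ≤
      gapSum (v : Fin n → ℝ) + 2 * (l.length : ℤ) := by
  induction l with
  | nil => simp
  | cons i l ih =>
    rw [List.map_cons, List.prod_cons, mul_apply, gen_apply]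
    have := gapSum_reflFun_le hn i (isGeneric_apply hn (l.map (gen n)).prod hv)
    rw [List.length_cons, Nat.cast_add_one]
    linarith

theorem wordLength_le {n : ℕ} [NeZero n] (l : List (Fin n)) :
    wordLength n (l.map (gen n)).prod ≤ l.length :=
  Nat.sInf_le ⟨l, rfl, rfl⟩

theorem prod_inv {n : ℕ} [NeZero n] (l : List (Fin n)) :
    (l.map (gen n)).prod⁻¹ = (l.reverse.map (gen n)).prod := by
  rw [List.prod_inv_reverse, List.map_map, List.map_reverse]
  congr 2

/-- The length of `w` is the number of hyperplanes between the alcoves `A₀` and `w A₀`. -/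
theorem two_mul_wordLength {n : ℕ} [NeZero n] (hn : 2 ≤ n) (w : affineSymm n) {p : V n}
    (hp : InBase (p : Fin n → ℝ)) :
    2 * (wordLength n w : ℤ) = gapSum ((w.1 p : V n) : Fin n → ℝ) := by
  obtain ⟨l, hl, hb⟩ := exists_word hn (w.1 p) (isGeneric_apply hn w hp.isGeneric)
  have hw : w = (l.reverse.map (gen n)).prod := by
    rw [← prod_inv]
    exact eq_inv_of_mul_eq_one_right (eq_one_of_inBase_apply hn hp hb)
  have h1 : wordLength n w ≤ l.length := by
    conv_lhs => rw [hw]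
    simpa using wordLength_le l.reverse
  obtain ⟨l', hl', hw'⟩ : wordLength n w ∈
      {k | ∃ l : List (Fin n), l.length = k ∧ (l.map (gen n)).prod = w} :=
    Nat.sInf_mem ⟨_, l.reverse, rfl, hw.symm⟩
  have h2 := gapSum_word_le hn l' p hp.isGeneric
  rw [hw', gapSum_of_inBase hp, hl'] at h2
  omega

theorem exists_eq_word {n : ℕ} [NeZero n] (hn : 2 ≤ n) (w : affineSymm n) :
    ∃ l : List (Fin n), l.length = wordLength n w ∧ (l.map (gen n)).prod = w := by
  obtain ⟨p, hp⟩ := exists_inBase n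
  obtain ⟨l, hl, hb⟩ := exists_word hn (w.1 p) (isGeneric_apply hn w hp.isGeneric)
  exact Nat.sInf_mem (s := {k | ∃ l : List (Fin n), l.length = k ∧ (l.map (gen n)).prod = w})
    ⟨_, l.reverse, rfl, by
      rw [← prod_inv]
      exact (eq_inv_of_mul_eq_one_right (eq_one_of_inBase_apply hn hp hb)).symm⟩

theorem wordLength_inv {n : ℕ} [NeZero n] (hn : 2 ≤ n) (w : affineSymm n) :
    wordLength n w⁻¹ = wordLength n w := by
  have H : ∀ w : affineSymm n, wordLength n w⁻¹ ≤ wordLength n w := fun w => by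
    obtain ⟨l, hl, hw⟩ := exists_eq_word hn w
    have := wordLength_le l.reverse
    rwa [← prod_inv, hw, List.length_reverse, hl] at this
  exact le_antisymm (H w) (by simpa using H w⁻¹)

/-! ### Minimal coset representatives -/

/-- Sorting the coordinates of a generic vector by the finite symmetric group. -/
theorem exists_sort {n : ℕ} [NeZero n] (hn : 2 ≤ n) (v : V n) (hv : IsGeneric (v : Fin n → ℝ)) :
    ∃ u ∈ finiteSymm n, StrictAnti ((u.1 v : V n) : Fin n → ℝ) := by
  induction hN : (gapSum (v : Fin n → ℝ)).toNat using Nat.strong_induction_on generalizing v with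
  | _ N ih =>
    by_cases hw : ∀ i : Fin n, i ≠ 0 → (v : Fin n → ℝ) i < (v : Fin n → ℝ) (i - 1)
    · exact ⟨1, one_mem _, strictAnti_of_pred hw⟩
    · push Not at hw
      obtain ⟨i, hi0, hi⟩ := hw
      have h0 : (v : Fin n → ℝ) (i - 1) - (v : Fin n → ℝ) i ≠ 0 := fun h =>
        hv (i - 1) i (pred_ne hn i) 0 (by push_cast; linarith)
      have h1 := gapSum_reflFun hn i hv (by
        simp only [shift, hi0, if_false, Int.cast_zero, add_zero]
        exact lt_of_le_of_ne (by linarith) h0)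
      have hg := isGeneric_reflFun hn i hv
      have hnn := gapSum_nonneg (reflFun n i v)
      obtain ⟨u, hu, hb⟩ := ih (gapSum (reflFun n i v)).toNat (by omega) ((gen n i).1 v) hg rfl
      exact ⟨u * gen n i, mul_mem hu (gen_mem_finiteSymm hi0), hb⟩

/-- Two elements with the same value at the origin, whose inverses map one point to points with
strictly decreasing coordinates, are equal. -/
theorem eq_of_strictAnti {n : ℕ} [NeZero n] (hn : 2 ≤ n) {w w' : affineSymm n} {p : V n}
    (h0 : w.1 0 = w'.1 0) (hw : StrictAnti ((w⁻¹.1 p : V n) : Fin n → ℝ))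
    (hw' : StrictAnti ((w'⁻¹.1 p : V n) : Fin n → ℝ)) : w = w' := by
  obtain ⟨σ, h⟩ := exists_perm_of_apply_zero hn (w := w⁻¹ * w')
    (by rw [mul_apply, ← h0, inv_apply_self])
  have h1 : w⁻¹.1 p = (w⁻¹ * w').1 (w'⁻¹.1 p) := by rw [mul_apply, apply_inv_self]
  have hσ : σ = 1 := by
    refine perm_eq_one_of_strictAnti hw' ?_
    rw [h1] at hw
    have : ((w'⁻¹.1 p : V n) : Fin n → ℝ) ∘ σ =
      (((w⁻¹ * w').1 (w'⁻¹.1 p) : V n) : Fin n → ℝ) := funext fun j => (h _ j).symm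
    rwa [this]
  have : w⁻¹ * w' = 1 := Subtype.ext (Equiv.ext fun v => V_ext fun j => by
    rw [h v j, hσ]; rfl)
  exact (inv_mul_eq_one.mp this)

/-- Minimal representatives are the elements whose inverses map the fundamental alcove into the
dominant chamber. -/
theorem isMinLeftCosetRep_iff {n : ℕ} [NeZero n] (hn : 2 ≤ n) (w : affineSymm n) {p : V n}
    (hp : InBase (p : Fin n → ℝ)) :
    IsMinLeftCosetRep n w ↔ StrictAnti ((w⁻¹.1 p : V n) : Fin n → ℝ) := by
  have H : ∀ w : affineSymm n, IsMinLeftCosetRep n w →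
      StrictAnti ((w⁻¹.1 p : V n) : Fin n → ℝ) := by
    intro w hw
    refine strictAnti_of_pred fun i hi => ?_
    by_contra hlt
    have hg := isGeneric_apply hn w⁻¹ hp.isGeneric
    have h0 : ((w⁻¹.1 p : V n) : Fin n → ℝ) (i - 1) - ((w⁻¹.1 p : V n) : Fin n → ℝ) i ≠ 0 :=
      fun h => hg (i - 1) i (pred_ne hn i) 0 (by rw [Int.cast_zero]; exact h)
    have h1 := gapSum_reflFun hn i hg (by
      simp only [shift, hi, if_false, Int.cast_zero, add_zero]
      exact lt_of_le_of_ne (by linarith) h0)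
    have h2 := hw _ (gen_mem_finiteSymm hi)
    rw [← wordLength_inv hn w, ← wordLength_inv hn (w * gen n i), mul_inv_rev, gen_inv] at h2
    have h3 := two_mul_wordLength hn w⁻¹ hp
    have h4 := two_mul_wordLength hn (gen n i * w⁻¹) hp
    rw [mul_apply, gen_apply] at h4
    omega
  refine ⟨H w, fun hw => ?_⟩
  -- a shortest element of the coset is also dominant, hence equal to `w`
  obtain ⟨u, hu, hmin⟩ : ∃ u ∈ finiteSymm n, ∀ u' ∈ finiteSymm n,
      wordLength n (w * u) ≤ wordLength n (w * u') := by
    obtain ⟨u, hu, hm⟩ := exists_minimalFor_of_wellFoundedLT (· ∈ finiteSymm n)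
      (fun u => wordLength n (w * u)) ⟨1, one_mem _⟩
    exact ⟨u, hu, fun u' hu' => (le_total _ _).elim id (hm hu')⟩
  have hmin' : IsMinLeftCosetRep n (w * u) := fun u' hu' => by
    rw [mul_assoc]; exact hmin _ (mul_mem hu hu')
  have : w * u = w := eq_of_strictAnti hn
    (by rw [mul_apply, finiteSymm_apply_zero hn hu]) (H _ hmin') hw
  rwa [this] at hmin'

/-- Every lattice vector is the image of the origin. -/
theorem exists_apply_zero {n : ℕ} [NeZero n] (hn : 2 ≤ n) (c : V n) (z : Fin n → ℤ)
    (hz : ∀ j, (c : Fin n → ℝ) j = z j) : ∃ w : affineSymm n, w.1 0 = c := by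
  obtain ⟨p, hp⟩ := exists_inBase n
  have hg : IsGeneric ((p + c : V n) : Fin n → ℝ) := by
    have := isGeneric_affine hp.isGeneric 1 z
    convert this using 1
    funext j
    simp [hz]
  obtain ⟨l, -, hb⟩ := exists_word hn (p + c) hg
  obtain ⟨σ, y, h⟩ := exists_perm hn (l.map (gen n)).prod
  have h2 : ∀ j, (((l.map (gen n)).prod.1 (p + c) : V n) : Fin n → ℝ) j =
      (p : Fin n → ℝ) (σ j) + ((z (σ j) + y j : ℤ) : ℝ) := fun j => by
    rw [h]
    simp [hz, add_assoc]
  obtain ⟨rfl, h3⟩ := eq_one_of_inBase hp hb (z := fun j => z (σ j) + y j) h2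
  refine ⟨(l.map (gen n)).prod⁻¹, ?_⟩
  have : (l.map (gen n)).prod.1 c = 0 := V_ext fun j => by
    rw [h, hz]
    have := congrFun h3 j
    simp only [Pi.zero_apply] at this
    change ((z _ : ℤ) : ℝ) + _ = 0
    exact_mod_cast this
  rw [← this, inv_apply_self]

/-! ### Alcoves and regions as classes of vectors -/

theorem dotProduct_root {n : ℕ} (v : Fin n → ℝ) (i j : Fin n) : v ⬝ᵥ root n i j = v i - v j := by
  simp [root, dotProduct_sub]

theorem mem_dominantChamber {n : ℕ} [NeZero n] {v : V n} :
    v ∈ dominantChamber n ↔ ∀ i : Fin n, i ≠ 0 → (v : Fin n → ℝ) i ≤ (v : Fin n → ℝ) (i - 1) := by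
  simp [dominantChamber, halfSpaceGE, simpleRoot, dotProduct_root]

theorem continuous_diff {n : ℕ} (i j : Fin n) :
    Continuous fun v : V n => (v : Fin n → ℝ) i - (v : Fin n → ℝ) j :=
  ((continuous_apply i).comp continuous_subtype_val).sub
    ((continuous_apply j).comp continuous_subtype_val)

theorem inBase_iff_walls {n : ℕ} [NeZero n] (hn : 2 ≤ n) {v : Fin n → ℝ} :
    InBase v ↔ ∀ i : Fin n, 0 < v (i - 1) - v i + shift i := by
  refine ⟨fun hv i => ?_, inBase_of_walls⟩
  have hp := val_pred i
  by_cases hi : i = 0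
  · rw [if_pos hi] at hp
    have hi0 : (i : ℕ) = 0 := by rw [hi]; rfl
    have := hv i (i - 1) (by rw [Fin.lt_def]; omega)
    simp only [shift, hi, if_true, Int.cast_one] at this ⊢
    linarith
  · rw [if_neg hi] at hp
    have hi0 : (i : ℕ) ≠ 0 := fun h => hi (Fin.ext h)
    have := hv (i - 1) i (by rw [Fin.lt_def]; omega)
    simp only [shift, hi, if_false, Int.cast_zero] at this ⊢
    linarith

theorem mem_fundamentalAlcove {n : ℕ} [NeZero n] (hn : 2 ≤ n) {v : V n} :
    v ∈ fundamentalAlcove n ↔ InBase (v : Fin n → ℝ) := by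
  have hK : ∀ v : V n, v ∈ halfSpaceLE n (highestRoot n) 1 ∩ dominantChamber n ↔
      ∀ i : Fin n, 0 ≤ (v : Fin n → ℝ) (i - 1) - (v : Fin n → ℝ) i + shift i := by
    intro v
    rw [Set.mem_inter_iff, mem_dominantChamber]
    simp only [halfSpaceLE, highestRoot, dotProduct_root, Set.mem_ofPred_eq, Int.cast_one]
    constructor
    · rintro ⟨h1, h2⟩ i
      by_cases hi : i = 0
      · simp only [shift, hi, if_true, Int.cast_one, zero_sub]; linarith
      · simp only [shift, hi, if_false, Int.cast_zero]; linarith [h2 i hi]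
    · intro h
      refine ⟨?_, fun i hi => ?_⟩
      · have := h 0
        simp only [shift, if_true, Int.cast_one, zero_sub] at this; linarith
      · have := h i
        simp only [shift, hi, if_false, Int.cast_zero] at this; linarith
  rw [inBase_iff_walls hn, fundamentalAlcove]
  constructor
  · intro hv i
    obtain ⟨p, hp⟩ := exists_inBase n
    -- push `v` away from an inner point: if `v` were on a wall, this would leave the chamber
    have hc : Continuous fun t : ℝ => v + t • (v - p) := by fun_prop
    have hnhds : ∀ᶠ t in nhdsWithin (0 : ℝ) (Set.Ioi 0), v + t • (v - p) ∈
        halfSpaceLE n (highestRoot n) 1 ∩ dominantChamber n := by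
      refine Filter.Eventually.filter_mono nhdsWithin_le_nhds ?_
      have h0 : v + (0 : ℝ) • (v - p) ∈
          interior (halfSpaceLE n (highestRoot n) 1 ∩ dominantChamber n) := by simpa using hv
      exact (hc.continuousAt.eventually (isOpen_interior.mem_nhds h0)).mono
        fun t ht => interior_subset ht
    obtain ⟨t, ht, ht0⟩ := (hnhds.and self_mem_nhdsWithin).exists
    have ht0 : 0 < t := ht0
    have h1 := (hK _).mp ht i
    have h2 := (inBase_iff_walls hn).mp hp i
    simp only [Submodule.coe_add, Submodule.coe_smul, Submodule.coe_sub, Pi.add_apply,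
      Pi.smul_apply, Pi.sub_apply, smul_eq_mul] at h1
    have h3 := mul_pos ht0 h2
    have h4 : 0 < (1 + t) * ((v : Fin n → ℝ) (i - 1) - (v : Fin n → ℝ) i + shift i) := by
      nlinarith
    exact pos_of_mul_pos_right h4 (by linarith)
  · intro hv
    have ho : IsOpen {v : V n | ∀ i : Fin n,
        0 < (v : Fin n → ℝ) (i - 1) - (v : Fin n → ℝ) i + shift i} := by
      simp only [Set.ofPred_forall]
      exact isOpen_iInter_of_finite fun i =>
        isOpen_lt continuous_const ((continuous_diff (i - 1) i).add continuous_const)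
    exact interior_maximal (fun v (hv : ∀ _, _) => (hK v).mpr fun i => (hv i).le) ho hv

theorem mem_alcove {n : ℕ} [NeZero n] (hn : 2 ≤ n) {w : affineSymm n} {y : V n} :
    y ∈ alcove n w ↔ InBase ((w⁻¹.1 y : V n) : Fin n → ℝ) := by
  rw [alcove, Set.mem_image, ← mem_fundamentalAlcove hn]
  constructor
  · rintro ⟨x, hx, rfl⟩
    rwa [inv_apply_self]
  · intro h
    exact ⟨_, h, apply_inv_self w y⟩

theorem apply_mem_alcove {n : ℕ} [NeZero n] (hn : 2 ≤ n) (w : affineSymm n) {p : V n}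
    (hp : InBase (p : Fin n → ℝ)) : w.1 p ∈ alcove n w := by
  rwa [mem_alcove hn, inv_apply_self]

/-- Distinct elements of the affine symmetric group have disjoint alcoves. -/
theorem eq_of_mem_alcove {n : ℕ} [NeZero n] (hn : 2 ≤ n) {w w' : affineSymm n} {y : V n}
    (h : y ∈ alcove n w) (h' : y ∈ alcove n w') : w = w' := by
  rw [mem_alcove hn] at h h'
  have : w'⁻¹ * w = 1 := eq_one_of_inBase_apply hn h (by
    rwa [mul_apply, apply_inv_self])
  exact (inv_mul_eq_one.mp this).symm

theorem alcove_injective {n : ℕ} [NeZero n] (hn : 2 ≤ n) : Function.Injective (alcove n) := by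
  intro w w' h
  obtain ⟨p, hp⟩ := exists_inBase n
  have := apply_mem_alcove hn w hp
  exact eq_of_mem_alcove hn this (h ▸ this)

/-- Every generic vector lies in an alcove `w A₀`. -/
theorem exists_mem_alcove {n : ℕ} [NeZero n] (hn : 2 ≤ n) {y : V n}
    (hy : IsGeneric (y : Fin n → ℝ)) : ∃ w, y ∈ alcove n w := by
  obtain ⟨l, -, hb⟩ := exists_word hn y hy
  exact ⟨(l.map (gen n)).prod⁻¹, by rwa [mem_alcove hn, inv_inv]⟩

theorem floor_eq_of_lt {n : ℕ} {x y : Fin n → ℝ} (hx : IsGeneric x) (hy : IsGeneric y)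
    (h : ∀ i j, i < j → ⌊y i - y j⌋ = ⌊x i - x j⌋) (i j : Fin n) :
    ⌊y i - y j⌋ = ⌊x i - x j⌋ := by
  rcases lt_trichotomy i j with hij | rfl | hij
  · exact h i j hij
  · simp
  · rw [hx.floor_swap hij.ne, hy.floor_swap hij.ne, h j i hij]

theorem inBase_iff_floor {n : ℕ} {y : Fin n → ℝ} :
    InBase y ↔ IsGeneric y ∧ ∀ i j, i < j → ⌊y i - y j⌋ = 0 := by
  refine ⟨fun h => ⟨h.isGeneric, fun i j hij => h.floor_eq hij⟩, fun ⟨hg, h⟩ i j hij => ?_⟩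
  obtain ⟨h1, h2⟩ := Int.floor_eq_zero_iff.mp (h i j hij)
  refine ⟨lt_of_le_of_ne h1 fun h0 => ?_, h2⟩
  exact hg i j hij.ne 0 (by rw [Int.cast_zero]; exact h0.symm)

theorem floor_apply_eq {n : ℕ} [NeZero n] (hn : 2 ≤ n) (w : affineSymm n) {x y : V n}
    (h : ∀ i j, ⌊(y : Fin n → ℝ) i - (y : Fin n → ℝ) j⌋ = ⌊(x : Fin n → ℝ) i - (x : Fin n → ℝ) j⌋)
    (i j : Fin n) :
    ⌊((w.1 y : V n) : Fin n → ℝ) i - ((w.1 y : V n) : Fin n → ℝ) j⌋ =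
      ⌊((w.1 x : V n) : Fin n → ℝ) i - ((w.1 x : V n) : Fin n → ℝ) j⌋ := by
  obtain ⟨σ, z, hw⟩ := exists_perm hn w
  simp only [hw]
  rw [floor_affine, floor_affine, h]

/-- An alcove consists of the generic vectors whose differences have given integer parts. -/
theorem mem_alcove_iff_floor {n : ℕ} [NeZero n] (hn : 2 ≤ n) {w : affineSymm n} {x y : V n}
    (hx : x ∈ alcove n w) :
    y ∈ alcove n w ↔ IsGeneric (y : Fin n → ℝ) ∧ ∀ i j, i < j →
      ⌊(y : Fin n → ℝ) i - (y : Fin n → ℝ) j⌋ = ⌊(x : Fin n → ℝ) i - (x : Fin n → ℝ) j⌋ := by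
  rw [mem_alcove hn] at hx ⊢
  have gen_iff : ∀ y : V n, InBase ((w⁻¹.1 y : V n) : Fin n → ℝ) → IsGeneric (y : Fin n → ℝ) :=
    fun y hy => by
      have := isGeneric_apply hn w hy.isGeneric
      rwa [apply_inv_self] at this
  constructor
  · intro hy
    refine ⟨gen_iff y hy, fun i j _ => ?_⟩
    have := floor_apply_eq hn w (floor_eq_of_lt hx.isGeneric hy.isGeneric
      fun i j hij => by rw [hx.floor_eq hij, hy.floor_eq hij]) i j
    rwa [apply_inv_self, apply_inv_self] at this
  · rintro ⟨hg, h⟩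
    rw [inBase_iff_floor]
    refine ⟨isGeneric_apply hn _ hg, fun i j hij => ?_⟩
    rw [floor_apply_eq hn w⁻¹ (floor_eq_of_lt (gen_iff x hx) hg h), hx.floor_eq hij]

/-- The components of the complement of an arrangement of hyperplanes `⟨·, ε_i - ε_j⟩ = k` are the
classes of vectors on the same side of every hyperplane. -/
theorem connectedComponentIn_eq {n : ℕ} {U : Set (V n)} {P : ℤ → Prop}
    (hU : ∀ v : V n, v ∈ U ↔ ∀ i j : Fin n, i < j → ∀ k, P k →
      (v : Fin n → ℝ) i - (v : Fin n → ℝ) j ≠ k) {x : V n} (hx : x ∈ U) :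
    connectedComponentIn U x = {y | y ∈ U ∧ ∀ i j : Fin n, i < j → ∀ k : ℤ, P k →
      ((k : ℝ) < (y : Fin n → ℝ) i - (y : Fin n → ℝ) j ↔
        (k : ℝ) < (x : Fin n → ℝ) i - (x : Fin n → ℝ) j)} := by
  apply subset_antisymm
  · intro y hy
    have hyU := connectedComponentIn_subset U x hy
    refine ⟨hyU, fun i j hij k hk => ?_⟩
    have hpre := isPreconnected_connectedComponentIn (F := U) (x := x)
    have hxC := mem_connectedComponentIn hx
    have hcont := (continuous_diff i j).continuousOn (s := connectedComponentIn U x)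
    -- the difference of two coordinates is continuous and misses the value `k`
    have hne : ∀ v ∈ connectedComponentIn U x, (v : Fin n → ℝ) i - (v : Fin n → ℝ) j ≠ k :=
      fun v hv => (hU v).mp (connectedComponentIn_subset U x hv) i j hij k hk
    constructor
    · intro h
      by_contra hxk
      obtain ⟨v, hv, hvk⟩ := hpre.intermediate_value hxC hy hcont ⟨not_lt.mp hxk, h.le⟩
      exact hne v hv hvk
    · intro h
      by_contra hyk
      obtain ⟨v, hv, hvk⟩ := hpre.intermediate_value hy hxC hcont ⟨not_lt.mp hyk, h.le⟩
      exact hne v hv hvk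
  · refine IsPreconnected.subset_connectedComponentIn ?_ ⟨hx, fun _ _ _ _ _ => Iff.rfl⟩
      (fun y hy => hy.1)
    apply Convex.isPreconnected 
    rintro y ⟨hyU, hy⟩ z ⟨hzU, hz⟩ a b ha hb hab
    have key : ∀ i j : Fin n, i < j → ∀ k : ℤ, P k →
        ((k : ℝ) < (x : Fin n → ℝ) i - (x : Fin n → ℝ) j →
          (k : ℝ) < ((a • y + b • z : V n) : Fin n → ℝ) i -
            ((a • y + b • z : V n) : Fin n → ℝ) j) ∧
        (¬ (k : ℝ) < (x : Fin n → ℝ) i - (x : Fin n → ℝ) j →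
          ((a • y + b • z : V n) : Fin n → ℝ) i -
            ((a • y + b • z : V n) : Fin n → ℝ) j < k) := by
      intro i j hij k hk
      have e : ((a • y + b • z : V n) : Fin n → ℝ) i - ((a • y + b • z : V n) : Fin n → ℝ) j =
          a • ((y : Fin n → ℝ) i - (y : Fin n → ℝ) j) +
          b • ((z : Fin n → ℝ) i - (z : Fin n → ℝ) j) := by
        simp; ring
      rw [e]
      constructor
      · intro h
        exact convex_Ioi (𝕜 := ℝ) (k : ℝ) ((hy i j hij k hk).mpr h) ((hz i j hij k hk).mpr h)
          ha hb hab
      · intro h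
        refine convex_Iio (𝕜 := ℝ) (k : ℝ) ?_ ?_ ha hb hab
        · exact lt_of_le_of_ne (not_lt.mp fun h' => h ((hy i j hij k hk).mp h'))
            ((hU y).mp hyU i j hij k hk)
        · exact lt_of_le_of_ne (not_lt.mp fun h' => h ((hz i j hij k hk).mp h'))
            ((hU z).mp hzU i j hij k hk)
    refine ⟨(hU _).mpr fun i j hij k hk => ?_, fun i j hij k hk => ⟨fun h => ?_, fun h => ?_⟩⟩
    · by_cases h : (k : ℝ) < (x : Fin n → ℝ) i - (x : Fin n → ℝ) j
      · exact ((key i j hij k hk).1 h).ne'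
      · exact ((key i j hij k hk).2 h).ne
    · by_contra h'
      exact lt_asymm h ((key i j hij k hk).2 h')
    · exact (key i j hij k hk).1 h

theorem lt_iff_le_floor {x : ℝ} {k : ℤ} (h : x ≠ k) : (k : ℝ) < x ↔ k ≤ ⌊x⌋ := by
  rw [Int.le_floor]
  exact ⟨le_of_lt, fun h' => lt_of_le_of_ne h' h.symm⟩

/-- The alcoves are the images of the fundamental alcove. -/
theorem isAlcove_iff {n : ℕ} [NeZero n] (hn : 2 ≤ n) {A : Set (V n)} :
    IsAlcove n A ↔ ∃ w, A = alcove n w := by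
  have hU : ∀ v : V n, v ∈ (⋃ (i : Fin n) (j : Fin n) (_ : i < j) (k : ℤ),
      hyperplane n (root n i j) k)ᶜ ↔ ∀ i j : Fin n, i < j → ∀ k : ℤ, True →
      (v : Fin n → ℝ) i - (v : Fin n → ℝ) j ≠ k := by
    intro v
    simp [hyperplane, dotProduct_root]
  have hgen : ∀ v : V n, v ∈ (⋃ (i : Fin n) (j : Fin n) (_ : i < j) (k : ℤ),
      hyperplane n (root n i j) k)ᶜ ↔ IsGeneric (v : Fin n → ℝ) := by
    intro v
    rw [hU]
    refine ⟨fun h i j hij k hk => ?_, fun h i j hij k _ => h i j hij.ne k⟩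
    rcases lt_or_gt_of_ne hij with hij | hij
    · exact h i j hij k trivial hk
    · exact h j i hij (-k) trivial (by rw [Int.cast_neg, ← hk, neg_sub])
  have key : ∀ (x : V n) (w : affineSymm n), x ∈ alcove n w → IsGeneric (x : Fin n → ℝ) →
      connectedComponentIn (⋃ (i : Fin n) (j : Fin n) (_ : i < j) (k : ℤ),
      hyperplane n (root n i j) k)ᶜ x = alcove n w := by
    intro x w hxw hx
    rw [connectedComponentIn_eq hU ((hgen x).mpr hx)]
    ext y
    rw [mem_alcove_iff_floor hn hxw, Set.mem_ofPred_eq, hgen]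
    refine and_congr_right fun hy => forall_congr' fun i => forall_congr' fun j =>
      forall_congr' fun hij => ?_
    constructor
    · intro h
      refine eq_of_forall_le_iff fun k => ?_
      rw [← lt_iff_le_floor (hy i j hij.ne k), ← lt_iff_le_floor (hx i j hij.ne k)]
      exact h k trivial
    · intro h k _
      rw [lt_iff_le_floor (hy i j hij.ne k), lt_iff_le_floor (hx i j hij.ne k), h]
  constructor
  · rintro ⟨x, hx, rfl⟩
    obtain ⟨w, hw⟩ := exists_mem_alcove hn ((hgen x).mp hx)
    exact ⟨w, key x w hw ((hgen x).mp hx)⟩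
  · rintro ⟨w, rfl⟩
    obtain ⟨p, hp⟩ := exists_inBase n
    have hg := isGeneric_apply hn w hp.isGeneric
    exact ⟨w.1 p, (hgen _).mpr hg, (key _ w (apply_mem_alcove hn w hp) hg).symm⟩

theorem alcove_subset_dominantChamber_iff {n : ℕ} [NeZero n] (hn : 2 ≤ n) {w : affineSymm n}
    {p : V n} (hp : InBase (p : Fin n → ℝ)) :
    alcove n w ⊆ dominantChamber n ↔ StrictAnti ((w.1 p : V n) : Fin n → ℝ) := by
  have hw := apply_mem_alcove hn w hp
  have hg := isGeneric_apply hn w hp.isGeneric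
  constructor
  · intro h
    refine strictAnti_of_pred fun i hi => lt_of_le_of_ne (mem_dominantChamber.mp (h hw) i hi) ?_
    exact fun h => hg i (i - 1) (pred_ne hn i).symm 0 (by rw [h]; simp)
  · intro h y hy
    rw [mem_alcove_iff_floor hn hw] at hy
    refine mem_dominantChamber.mpr fun i hi => ?_
    have hlt : i - 1 < i := by
      have hp := val_pred i
      rw [if_neg hi] at hp
      have hi0 : (i : ℕ) ≠ 0 := fun h => hi (Fin.ext h)
      rw [Fin.lt_def]; omega
    have h1 : 0 ≤ ⌊((w.1 p : V n) : Fin n → ℝ) (i - 1) - ((w.1 p : V n) : Fin n → ℝ) i⌋ :=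
      Int.floor_nonneg.mpr (by linarith [h hlt])
    rw [← hy.2 _ _ hlt, Int.floor_nonneg] at h1
    linarith

/-- The vector lies on no hyperplane of the `m`-Shi arrangement. -/
def ShiGeneric {n : ℕ} (m : ℕ) (v : Fin n → ℝ) : Prop :=
  ∀ i j : Fin n, i < j → ∀ k : ℤ, (-(m : ℤ) < k ∧ k ≤ m) → v i - v j ≠ k

/-- The two vectors lie on the same side of every hyperplane of the `m`-Shi arrangement. -/
def SameShiSide {n : ℕ} (m : ℕ) (x y : Fin n → ℝ) : Prop :=
  ∀ i j : Fin n, i < j → ∀ k : ℤ, (-(m : ℤ) < k ∧ k ≤ m) →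
    ((k : ℝ) < y i - y j ↔ (k : ℝ) < x i - x j)

/-- The region of the `m`-Shi arrangement that contains `x`. -/
def shiClass {n : ℕ} (m : ℕ) (x : V n) : Set (V n) :=
  {y | ShiGeneric m (y : Fin n → ℝ) ∧ SameShiSide m (x : Fin n → ℝ) (y : Fin n → ℝ)}

theorem IsGeneric.shiGeneric {n : ℕ} {v : Fin n → ℝ} (hv : IsGeneric v) (m : ℕ) :
    ShiGeneric m v :=
  fun i j hij k _ => hv i j hij.ne k

theorem isShiRegion_iff {n m : ℕ} {R : Set (V n)} :
    IsShiRegion n m R ↔ ∃ x : V n, ShiGeneric m (x : Fin n → ℝ) ∧ R = shiClass m x := by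
  have hU : ∀ v : V n, v ∈ (⋃ (i : Fin n) (j : Fin n) (_ : i < j) (k : ℤ)
      (_ : -(m : ℤ) < k ∧ k ≤ m), hyperplane n (root n i j) k)ᶜ ↔ ∀ i j : Fin n, i < j →
      ∀ k : ℤ, (-(m : ℤ) < k ∧ k ≤ m) → (v : Fin n → ℝ) i - (v : Fin n → ℝ) j ≠ k := by
    intro v
    simp only [hyperplane, dotProduct_root, Set.mem_compl_iff, Set.mem_iUnion,
      Set.mem_ofPred_eq, not_exists]
  have key : ∀ x : V n, ShiGeneric m (x : Fin n → ℝ) →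
      connectedComponentIn (⋃ (i : Fin n) (j : Fin n) (_ : i < j) (k : ℤ)
      (_ : -(m : ℤ) < k ∧ k ≤ m), hyperplane n (root n i j) k)ᶜ x = shiClass m x := by
    intro x hx
    rw [connectedComponentIn_eq hU ((hU x).mpr hx)]
    ext y
    rw [Set.mem_ofPred_eq, hU]
    rfl
  constructor
  · rintro ⟨x, hx, rfl⟩
    exact ⟨x, (hU x).mp hx, key x ((hU x).mp hx)⟩
  · rintro ⟨x, hx, rfl⟩
    exact ⟨x, (hU x).mpr hx, (key x hx).symm⟩

theorem self_mem_shiClass {n m : ℕ} {x : V n} (hx : ShiGeneric m (x : Fin n → ℝ)) :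
    x ∈ shiClass m x := ⟨hx, fun _ _ _ _ _ => Iff.rfl⟩

theorem shiClass_eq_of_mem {n m : ℕ} {x y : V n} (h : y ∈ shiClass m x) :
    shiClass m y = shiClass m x := by
  ext z
  refine and_congr_right fun _ => ?_
  constructor
  · intro hz i j hij k hk
    rw [hz i j hij k hk, h.2 i j hij k hk]
  · intro hz i j hij k hk
    rw [hz i j hij k hk, h.2 i j hij k hk]

theorem IsShiRegion.eq_shiClass {n m : ℕ} {R : Set (V n)} (hR : IsShiRegion n m R) {y : V n}
    (hy : y ∈ R) : R = shiClass m y := by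
  obtain ⟨x, hx, rfl⟩ := isShiRegion_iff.mp hR
  exact (shiClass_eq_of_mem hy).symm

theorem isShiRegion_shiClass {n m : ℕ} {x : V n} (hx : ShiGeneric m (x : Fin n → ℝ)) :
    IsShiRegion n m (shiClass m x) := isShiRegion_iff.mpr ⟨x, hx, rfl⟩

theorem mem_shiClass_of_floor {n m : ℕ} {x y : V n} (hx : ShiGeneric m (x : Fin n → ℝ))
    (hy : IsGeneric (y : Fin n → ℝ))
    (h : ∀ i j, i < j → ⌊(y : Fin n → ℝ) i - (y : Fin n → ℝ) j⌋ =
      ⌊(x : Fin n → ℝ) i - (x : Fin n → ℝ) j⌋) : y ∈ shiClass m x := by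
  refine ⟨hy.shiGeneric m, fun i j hij k hk => ?_⟩
  rw [lt_iff_le_floor (hy i j hij.ne k), lt_iff_le_floor (hx i j hij k hk), h i j hij]

theorem alcove_subset_shiRegion_iff {n m : ℕ} [NeZero n] (hn : 2 ≤ n) {R : Set (V n)}
    (hR : IsShiRegion n m R) (w : affineSymm n) {p : V n} (hp : InBase (p : Fin n → ℝ)) :
    alcove n w ⊆ R ↔ w.1 p ∈ R := by
  have hw := apply_mem_alcove hn w hp
  refine ⟨fun h => h hw, fun h y hy => ?_⟩
  rw [hR.eq_shiClass h]
  obtain ⟨h1, h2⟩ := (mem_alcove_iff_floor hn hw).mp hy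
  exact mem_shiClass_of_floor ((isGeneric_apply hn w hp.isGeneric).shiGeneric m) h1 h2

/-- Every region contains an alcove: a small multiple of a point of the fundamental alcove moves a
vector off all hyperplanes without changing the integer parts of its differences. -/
theorem exists_alcove_subset {n m : ℕ} [NeZero n] (hn : 2 ≤ n) {R : Set (V n)}
    (hR : IsShiRegion n m R) : ∃ w, alcove n w ⊆ R := by
  obtain ⟨x, hx, rfl⟩ := isShiRegion_iff.mp hR
  obtain ⟨p, hp⟩ := exists_inBase n
  have hev : ∀ᶠ t in nhdsWithin (0 : ℝ) (Set.Ioi 0), ∀ a : Fin n × Fin n,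
      t < 1 - Int.fract ((x : Fin n → ℝ) a.1 - (x : Fin n → ℝ) a.2) := by
    rw [Filter.eventually_all]
    intro a
    refine Filter.Eventually.filter_mono nhdsWithin_le_nhds (eventually_lt_nhds ?_)
    linarith [Int.fract_lt_one ((x : Fin n → ℝ) a.1 - (x : Fin n → ℝ) a.2)]
  obtain ⟨t, ht, ht0⟩ := (hev.and self_mem_nhdsWithin).exists
  have ht0 : 0 < t := ht0
  set y : V n := x + t • p with hy
  have key : ∀ i j, i < j →
      (⌊(x : Fin n → ℝ) i - (x : Fin n → ℝ) j⌋ : ℝ) < (y : Fin n → ℝ) i - (y : Fin n → ℝ) j ∧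
      (y : Fin n → ℝ) i - (y : Fin n → ℝ) j < ⌊(x : Fin n → ℝ) i - (x : Fin n → ℝ) j⌋ + 1 := by
    intro i j hij
    have h1 := ht (i, j)
    have h2 := hp i j hij
    have h3 := Int.floor_add_fract ((x : Fin n → ℝ) i - (x : Fin n → ℝ) j)
    have h4 := Int.fract_nonneg ((x : Fin n → ℝ) i - (x : Fin n → ℝ) j)
    have h5 : (y : Fin n → ℝ) i - (y : Fin n → ℝ) j = ((x : Fin n → ℝ) i - (x : Fin n → ℝ) j) +
        t * ((p : Fin n → ℝ) i - (p : Fin n → ℝ) j) := by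
      simp [hy]; ring
    have h6 := mul_pos ht0 h2.1
    have h7 : t * ((p : Fin n → ℝ) i - (p : Fin n → ℝ) j) < t * 1 :=
      mul_lt_mul_of_pos_left h2.2 ht0
    simp only at h1
    constructor <;> linarith
  have hlt : ∀ i j, i < j → ∀ k : ℤ, (y : Fin n → ℝ) i - (y : Fin n → ℝ) j ≠ k := by
    intro i j hij k hk
    obtain ⟨h1, h2⟩ := key i j hij
    rw [hk] at h1 h2
    have h1 : ⌊(x : Fin n → ℝ) i - (x : Fin n → ℝ) j⌋ < k := by exact_mod_cast h1
    have h2 : k < ⌊(x : Fin n → ℝ) i - (x : Fin n → ℝ) j⌋ + 1 := by exact_mod_cast h2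
    omega
  have hyg : IsGeneric (y : Fin n → ℝ) := by
    intro i j hij k hk
    rcases lt_or_gt_of_ne hij with hij | hij
    · exact hlt i j hij k hk
    · exact hlt j i hij (-k) (by rw [Int.cast_neg, ← hk, neg_sub])
  have hyR : y ∈ shiClass m x := mem_shiClass_of_floor hx hyg fun i j hij => by
    rw [Int.floor_eq_iff]
    exact ⟨(key i j hij).1.le, (key i j hij).2⟩
  obtain ⟨w, hw⟩ := exists_mem_alcove hn hyg
  refine ⟨w, fun v hv => ?_⟩
  rw [← shiClass_eq_of_mem hyR]
  obtain ⟨h1, h2⟩ := (mem_alcove_iff_floor hn hw).mp hv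
  exact mem_shiClass_of_floor (hyg.shiGeneric m) h1 h2

theorem shiClass_subset_dominantChamber {n m : ℕ} [NeZero n] (hm : 1 ≤ m) {x : V n}
    (hx : StrictAnti (x : Fin n → ℝ)) : shiClass m x ⊆ dominantChamber n := by
  intro y hy
  refine mem_dominantChamber.mpr fun i hi => ?_
  have hlt : i - 1 < i := by
    have hp := val_pred i
    rw [if_neg hi] at hp
    have hi0 : (i : ℕ) ≠ 0 := fun h => hi (Fin.ext h)
    rw [Fin.lt_def]; omega
  have := (hy.2 (i - 1) i hlt 0 (by omega)).mpr (by rw [Int.cast_zero]; linarith [hx hlt])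
  rw [Int.cast_zero] at this
  linarith

/-! ### Minimal alcoves -/

/-- The lattice vector `c` lies in the dilated simplex bounded by the walls of the fundamental
alcove moved out by `m`: `⟨c, α_i⟩ ≥ -m` for `i ≠ 0` and `⟨c, θ⟩ ≤ m + 1`. -/
def InDilate {n : ℕ} [NeZero n] (m : ℕ) (c : Fin n → ℤ) : Prop :=
  ∀ i : Fin n, c i - c (i - 1) ≤ m + shift i

/-- In a sequence `C` whose steps are at most `m`, an ascent of positive height can be cut into
ascents of heights between `1` and `m`; lower bounds for the latter add up. -/
theorem le_sub_of_steps {C : ℕ → ℤ} {E : ℕ → ℝ} {m n : ℕ} (step : ∀ t, C (t + 1) ≤ C t + m)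
    (h : ∀ s t, s < t → t < s + n → 1 ≤ C t - C s → C t - C s ≤ m →
      ((C t - C s : ℤ) : ℝ) ≤ E s - E t)
    (s t : ℕ) (hst : s < t) (hts : t < s + n) (h1 : 1 ≤ C t - C s) :
    ((C t - C s : ℤ) : ℝ) ≤ E s - E t := by
  induction hd : t - s using Nat.strong_induction_on generalizing s with
  | _ d ih =>
    by_cases hm : C t - C s ≤ m
    · exact h s t hst hts h1 hm
    · -- cut at the first place `r` after `s` where the sequence exceeds its value at `s`
      have hex : ∃ r, s < r ∧ C s < C r := ⟨t, hst, by omega⟩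
      classical
      obtain ⟨hr1, hr2⟩ := Nat.find_spec hex
      have hrt : Nat.find hex ≤ t := Nat.find_min' hex ⟨hst, by omega⟩
      set r := Nat.find hex with hr
      have hprev : C (r - 1) ≤ C s := by
        by_contra hlt
        rcases Nat.lt_or_ge s (r - 1) with hs | hs
        · exact Nat.find_min hex (m := r - 1) (by omega) ⟨hs, by omega⟩
        · have : r - 1 = s := by omega
          rw [this] at hlt
          exact hlt le_rfl
      have hstep := step (r - 1)
      rw [show r - 1 + 1 = r by omega] at hstep
      have hne : r ≠ t := by
        intro h
        rw [h] at hstep hprev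
        omega
      have e1 := h s r hr1 (by omega) (by omega) (by omega)
      have e2 := ih (t - r) (by omega) r (by omega) (by omega) (by omega) rfl
      push_cast at e1 e2 ⊢
      linarith

theorem floor_inBase_reflFun {n : ℕ} [NeZero n] (hn : 2 ≤ n) (i : Fin n) {p : Fin n → ℝ}
    (hp : InBase p) {a b : Fin n} (hab : a < b) (h1 : ¬ (a = i - 1 ∧ b = i))
    (h2 : ¬ (a = i ∧ b = i - 1)) :
    0 < reflFun n i p a - reflFun n i p b ∧ reflFun n i p a - reflFun n i p b < 1 := by
  have hpi := val_pred i
  have hne := pred_ne hn i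
  have ha := a.2
  have hb := b.2
  have hin := i.2
  have hab' : (a : ℕ) < b := hab
  rw [reflFun_apply hn, reflFun_apply hn]
  by_cases hi : i = 0
  · have hs : shift i = 1 := by simp [shift, hi]
    rw [if_pos hi] at hpi
    have hi0 : (i : ℕ) = 0 := by rw [hi]; rfl
    have hbi : b ≠ i := by rintro rfl; omega
    have hai : a ≠ i - 1 := by intro h; have := congrArg Fin.val h; omega
    rw [if_neg hbi, if_neg hai, hs]
    by_cases ha' : a = i
    · have hb' : b ≠ i - 1 := fun h => h2 ⟨ha', h⟩
      have hlt : b < i - 1 := by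
        rw [Fin.lt_def]; have : (b : ℕ) ≠ (i - 1 : Fin n) := fun h => hb' (Fin.ext h); omega
      rw [if_pos ha', if_neg hb', ha', Equiv.swap_apply_right,
        Equiv.swap_apply_of_ne_of_ne hb' hbi]
      have := hp _ _ hlt
      push_cast
      constructor <;> linarith
    · rw [if_neg ha', Equiv.swap_apply_of_ne_of_ne hai ha']
      by_cases hb' : b = i - 1
      · have hlt : i < a := by
          rw [Fin.lt_def]; have : (a : ℕ) ≠ i := fun h => ha' (Fin.ext h); omega
        rw [if_pos hb', hb', Equiv.swap_apply_left]
        have := hp _ _ hlt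
        push_cast
        constructor <;> linarith
      · rw [if_neg hb', Equiv.swap_apply_of_ne_of_ne hb' hbi]
        simpa using hp _ _ hab
  · have hs : shift i = 0 := by simp [shift, hi]
    rw [if_neg hi] at hpi
    have hi0 : (i : ℕ) ≠ 0 := fun h => hi (Fin.ext h)
    have hlt : Equiv.swap (i - 1) i a < Equiv.swap (i - 1) i b := by
      rw [Fin.lt_def]
      simp only [Equiv.swap_apply_def, Fin.ext_iff] at h1 h2 ⊢
      split_ifs <;> omega
    rw [hs]
    simpa using hp _ _ hlt

/-- If `x` maps the lattice vector `c` to the origin, then `x` subtracts `c` and permutes the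
coordinates. -/
theorem exists_perm_sub {n : ℕ} [NeZero n] (hn : 2 ≤ n) {x : affineSymm n} {c : Fin n → ℤ}
    (hc : ∀ j, ((x⁻¹.1 0 : V n) : Fin n → ℝ) j = c j) :
    ∃ σ : Equiv.Perm (Fin n), ∀ (v : V n) (j : Fin n),
      ((x.1 v : V n) : Fin n → ℝ) j = (v : Fin n → ℝ) (σ j) - c (σ j) := by
  obtain ⟨σ, z, h⟩ := exists_perm hn x
  refine ⟨σ, fun v j => ?_⟩
  have h0 := h (x⁻¹.1 0) j
  rw [apply_inv_self, hc] at h0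
  have h0 : (0 : ℝ) = c (σ j) + z j := h0
  rw [h v j]
  linarith

theorem floor_apply_of_sub {n : ℕ} [NeZero n] {x : affineSymm n} {c : Fin n → ℤ}
    {σ : Equiv.Perm (Fin n)} {v : V n} (hσ : ∀ j : Fin n,
      ((x.1 v : V n) : Fin n → ℝ) j = (v : Fin n → ℝ) (σ j) - c (σ j)) (i j : Fin n) :
    ⌊((x.1 v : V n) : Fin n → ℝ) i - ((x.1 v : V n) : Fin n → ℝ) j⌋ =
      ⌊(v : Fin n → ℝ) (σ i) - (v : Fin n → ℝ) (σ j)⌋ + (c (σ j) - c (σ i)) := by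
  rw [hσ, hσ, ← Int.floor_add_intCast]
  congr 1
  push_cast
  ring

/-- If `c = x⁻¹ 0` violates the `i`-th inequality, then the `i`-th wall of the dominant alcove
`x A₀` is not in the `m`-Shi arrangement and separates `x A₀` from the fundamental alcove: the
neighbour `x s_i A₀` is in the same region and shorter. -/
theorem exists_shorter {n m : ℕ} [NeZero n] (hn : 2 ≤ n) {x : affineSymm n} {c : Fin n → ℤ}
    (hc : ∀ j, ((x⁻¹.1 0 : V n) : Fin n → ℝ) j = c j) {p : V n} (hp : InBase (p : Fin n → ℝ))
    (hx : StrictAnti ((x.1 p : V n) : Fin n → ℝ)) {i : Fin n}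
    (hi : ¬ c i - c (i - 1) ≤ m + shift i) :
    (x * gen n i).1 p ∈ shiClass m (x.1 p) ∧
      wordLength n (x * gen n i) < wordLength n x := by
  obtain ⟨σ, hσ⟩ := exists_perm_sub hn hc
  have hne := pred_ne hn i
  have hxg := isGeneric_apply hn x hp.isGeneric
  have hqg : IsGeneric (((gen n i).1 p : V n) : Fin n → ℝ) := isGeneric_apply hn _ hp.isGeneric
  have hxqg := isGeneric_apply hn (x * gen n i) hp.isGeneric
  set a := σ.symm (i - 1) with ha
  set b := σ.symm i with hb
  have hσa : σ a = i - 1 := by simp [ha]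
  have hσb : σ b = i := by simp [hb]
  have hfl : ⌊(p : Fin n → ℝ) (i - 1) - (p : Fin n → ℝ) i⌋ = - shift i := by
    have hpi := val_pred i
    have hin := i.2
    by_cases h0 : i = 0
    · rw [if_pos h0] at hpi
      have hi0 : (i : ℕ) = 0 := by rw [h0]; rfl
      rw [hp.isGeneric.floor_swap hne.symm, hp.floor_eq (by rw [Fin.lt_def]; omega)]
      simp [shift, h0]
    · rw [if_neg h0] at hpi
      have hi0 : (i : ℕ) ≠ 0 := fun h => h0 (Fin.ext h)
      rw [hp.floor_eq (by rw [Fin.lt_def]; omega)]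
      simp [shift, h0]
  have hs01 : shift i = 0 ∨ shift i = 1 := by unfold shift; split_ifs <;> simp
  have hfq : ⌊(((gen n i).1 p : V n) : Fin n → ℝ) (i - 1) -
      (((gen n i).1 p : V n) : Fin n → ℝ) i⌋ = - shift i - 1 := by
    have e1 : reflFun n i p i = (p : Fin n → ℝ) (i - 1) + (shift i : ℝ) := by
      rw [reflFun_apply hn]; simp
    have e2 : reflFun n i p (i - 1) = (p : Fin n → ℝ) i - (shift i : ℝ) := by
      rw [reflFun_apply hn]; simp [hne]; ring
    rw [gen_apply, e1, e2]
    have : (p : Fin n → ℝ) i - (shift i : ℝ) - ((p : Fin n → ℝ) (i - 1) + (shift i : ℝ)) =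
      ((p : Fin n → ℝ) i - (p : Fin n → ℝ) (i - 1)) + ((-2 * shift i : ℤ) : ℝ) := by
      push_cast; ring
    rw [this, Int.floor_add_intCast, hp.isGeneric.floor_swap hne, hfl]
    ring
  have fx := floor_apply_of_sub (hσ p) a b
  have fq := floor_apply_of_sub (hσ ((gen n i).1 p)) a b
  rw [hσa, hσb, hfl] at fx
  rw [hσa, hσb, hfq, ← mul_apply] at fq
  have hab : a < b := by
    by_contra h
    have hba : b < a := lt_of_le_of_ne (not_lt.mp h) fun h => hne (by rw [← hσa, ← hσb, h])
    have h1 : ((x.1 p : V n) : Fin n → ℝ) a - ((x.1 p : V n) : Fin n → ℝ) b < 0 := by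
      linarith [hx hba]
    have h2 : ⌊((x.1 p : V n) : Fin n → ℝ) a - ((x.1 p : V n) : Fin n → ℝ) b⌋ < 0 := by
      rw [Int.floor_lt]; simpa using h1
    omega
  have hother : ∀ a' b' : Fin n, a' < b' → ¬ (a' = a ∧ b' = b) →
      ⌊(((x * gen n i).1 p : V n) : Fin n → ℝ) a' - (((x * gen n i).1 p : V n) : Fin n → ℝ) b'⌋ =
      ⌊((x.1 p : V n) : Fin n → ℝ) a' - ((x.1 p : V n) : Fin n → ℝ) b'⌋ := by
    intro a' b' hab' hne'
    have h1 : ¬ (σ a' = i - 1 ∧ σ b' = i) := fun h =>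
      hne' ⟨by rw [ha, ← h.1, σ.symm_apply_apply], by rw [hb, ← h.2, σ.symm_apply_apply]⟩
    have h2 : ¬ (σ a' = i ∧ σ b' = i - 1) := fun h => by
      have e1 : a' = b := by rw [hb, ← h.1, σ.symm_apply_apply]
      have e2 : b' = a := by rw [ha, ← h.2, σ.symm_apply_apply]
      rw [e1, e2] at hab'
      exact lt_asymm hab hab'
    rw [mul_apply, floor_apply_of_sub (hσ p), floor_apply_of_sub (hσ ((gen n i).1 p))]
    congr 1
    rcases lt_trichotomy (σ a') (σ b') with hlt | heq | hlt
    · have := floor_inBase_reflFun hn i hp hlt h1 h2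
      rw [hp.floor_eq hlt, Int.floor_eq_zero_iff]
      exact ⟨this.1.le, this.2⟩
    · exact absurd (σ.injective heq) hab'.ne
    · have := floor_inBase_reflFun hn i hp hlt (fun h => h2 ⟨h.2, h.1⟩) (fun h => h1 ⟨h.2, h.1⟩)
      rw [hqg.floor_swap hlt.ne, hp.isGeneric.floor_swap hlt.ne, hp.floor_eq hlt]
      congr 2
      rw [Int.floor_eq_zero_iff]
      exact ⟨this.1.le, this.2⟩
  constructor
  · refine ⟨hxqg.shiGeneric m, fun a' b' hab' k hk => ?_⟩
    rw [lt_iff_le_floor (hxqg a' b' hab'.ne k), lt_iff_le_floor (hxg a' b' hab'.ne k)]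
    by_cases h : a' = a ∧ b' = b
    · obtain ⟨rfl, rfl⟩ := h
      omega
    · rw [hother a' b' hab' h]
  · have h1 := two_mul_wordLength hn x hp
    have h2 := two_mul_wordLength hn (x * gen n i) hp
    have h3 : gapSum (((x * gen n i).1 p : V n) : Fin n → ℝ) <
        gapSum ((x.1 p : V n) : Fin n → ℝ) := by
      refine Finset.sum_lt_sum (fun y _ => ?_) ⟨(a, b), Finset.mem_univ _, ?_⟩
      · suffices H : ∀ a' b' : Fin n, a' < b' →
            |⌊(((x * gen n i).1 p : V n) : Fin n → ℝ) a' -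
              (((x * gen n i).1 p : V n) : Fin n → ℝ) b'⌋| ≤
            |⌊((x.1 p : V n) : Fin n → ℝ) a' - ((x.1 p : V n) : Fin n → ℝ) b'⌋| by
          unfold gap
          split_ifs with h1 h2
          · exact H _ _ h1
          · exact H _ _ h2
          · exact le_rfl
        intro a' b' hab'
        by_cases h : a' = a ∧ b' = b
        · obtain ⟨rfl, rfl⟩ := h
          rw [abs_of_nonneg (by omega), abs_of_nonneg (by omega)]
          omega
        · rw [hother a' b' hab' h]
      · change gap _ a b < gap _ a b
        rw [gap, gap, if_pos hab, if_pos hab, abs_of_nonneg (by omega), abs_of_nonneg (by omega)]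
        omega
    omega

/-- If `c = x⁻¹ 0` lies in the dilated simplex and `x A₀` is dominant, then no vector in the region
of `x A₀` is separated from the fundamental alcove by fewer hyperplanes in any direction. The
differences of the coordinates of `x A₀` have integer parts `C t - C s`, where `C` extends `c`
quasi-periodically; its steps are at most `m`. -/
theorem floor_le_of_inDilate {n m : ℕ} [NeZero n] (hn : 2 ≤ n) {x : affineSymm n} {c : Fin n → ℤ}
    (hc : ∀ j, ((x⁻¹.1 0 : V n) : Fin n → ℝ) j = c j) {p : V n} (hp : InBase (p : Fin n → ℝ))
    (hx : StrictAnti ((x.1 p : V n) : Fin n → ℝ)) (hm : InDilate m c) {y : V n}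
    (hy : y ∈ shiClass m (x.1 p)) {i j : Fin n} (hij : i < j) :
    0 ≤ ⌊((x.1 p : V n) : Fin n → ℝ) i - ((x.1 p : V n) : Fin n → ℝ) j⌋ ∧
    ⌊((x.1 p : V n) : Fin n → ℝ) i - ((x.1 p : V n) : Fin n → ℝ) j⌋ ≤
      |⌊(y : Fin n → ℝ) i - (y : Fin n → ℝ) j⌋| := by
  have h0 : 0 ≤ ⌊((x.1 p : V n) : Fin n → ℝ) i - ((x.1 p : V n) : Fin n → ℝ) j⌋ :=
    Int.floor_nonneg.mpr (by linarith [hx hij])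
  refine ⟨h0, ?_⟩
  rcases h0.eq_or_lt with h0 | h0
  · rw [← h0]; positivity
  obtain ⟨σ, hσ⟩ := exists_perm_sub hn hc
  set C : ℕ → ℤ := fun t => c (Fin.ofNat n t) - (t / n : ℕ) with hC
  set E : ℕ → ℝ := fun t => (y : Fin n → ℝ) (σ.symm (Fin.ofNat n t)) with hE
  have hn0 : 0 < n := by omega
  have step : ∀ t, C (t + 1) ≤ C t + m := by
    intro t
    have h1 := hm (Fin.ofNat n (t + 1))
    have h2 : Fin.ofNat n (t + 1) - 1 = Fin.ofNat n t := by
      rw [sub_eq_iff_eq_add]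
      apply Fin.ext
      simp [Fin.val_add]
    rw [h2] at h1
    simp only [hC]
    by_cases hd : n ∣ t + 1
    · have h3 : Fin.ofNat n (t + 1) = 0 := Fin.ext (by simpa using Nat.mod_eq_zero_of_dvd hd)
      rw [Nat.succ_div_of_dvd hd]
      simp only [shift, h3, if_true] at h1 ⊢
      push_cast
      omega
    · have h3 : Fin.ofNat n (t + 1) ≠ 0 := fun h => hd (Nat.dvd_of_mod_eq_zero (by
        simpa using congrArg Fin.val h))
      rw [Nat.succ_div_of_not_dvd hd]
      simp only [shift, h3, if_false] at h1 ⊢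
      omega
  have hfloor : ∀ s t, s < t → t < s + n →
      ⌊((x.1 p : V n) : Fin n → ℝ) (σ.symm (Fin.ofNat n s)) -
        ((x.1 p : V n) : Fin n → ℝ) (σ.symm (Fin.ofNat n t))⌋ = C t - C s := by
    intro s t hst hts
    rw [floor_apply_of_sub (hσ p), σ.apply_symm_apply, σ.apply_symm_apply]
    have hms := Nat.mod_lt s hn0
    have hmt := Nat.mod_lt t hn0
    have hds := Nat.div_add_mod s n
    have hdt := Nat.div_add_mod t n
    have hle : s / n ≤ t / n := Nat.div_le_div_right hst.le
    have hle' : t / n ≤ s / n + 1 := by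
      rw [← Nat.add_div_right s hn0]; exact Nat.div_le_div_right hts.le
    have hF : ∀ t : ℕ, ((Fin.ofNat n t : Fin n) : ℕ) = t % n := fun t => rfl
    simp only [hC]
    rcases hle.eq_or_lt with he | hlt
    · rw [he] at hds
      rw [hp.floor_eq (by rw [Fin.lt_def, hF, hF]; omega), he]
      ring
    · have he : t / n = s / n + 1 := by omega
      rw [he, mul_add] at hdt
      have hlt' : Fin.ofNat n t < Fin.ofNat n s := by rw [Fin.lt_def, hF, hF]; omega
      rw [hp.isGeneric.floor_swap hlt'.ne, hp.floor_eq hlt', he]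
      push_cast
      ring
  have hcut : ∀ s t, s < t → t < s + n → 1 ≤ C t - C s → C t - C s ≤ m →
      ((C t - C s : ℤ) : ℝ) ≤ E s - E t := by
    intro s t hst hts h1 h2
    have hf := hfloor s t hst hts
    have hle : ((C t - C s : ℤ) : ℝ) ≤
        ((x.1 p : V n) : Fin n → ℝ) (σ.symm (Fin.ofNat n s)) -
        ((x.1 p : V n) : Fin n → ℝ) (σ.symm (Fin.ofNat n t)) := by
      rw [← Int.le_floor, hf]
    have hpos : (1 : ℝ) ≤ ((C t - C s : ℤ) : ℝ) := by exact_mod_cast h1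
    have hlt : σ.symm (Fin.ofNat n s) < σ.symm (Fin.ofNat n t) :=
      hx.lt_iff_gt.mp (by linarith)
    have hgen := isGeneric_apply hn x hp.isGeneric _ _ hlt.ne (C t - C s)
    exact ((hy.2 _ _ hlt (C t - C s) (by omega)).mpr (lt_of_le_of_ne hle hgen.symm)).le
  have key : ⌊((x.1 p : V n) : Fin n → ℝ) i - ((x.1 p : V n) : Fin n → ℝ) j⌋ ≤
      ⌊(y : Fin n → ℝ) i - (y : Fin n → ℝ) j⌋ := by
    rw [Int.le_floor]
    obtain ⟨s, t, hst, hts, hs, ht⟩ : ∃ s t, s < t ∧ t < s + n ∧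
        Fin.ofNat n s = σ i ∧ Fin.ofNat n t = σ j := by
      have h1 := (σ i).2
      have h2 := (σ j).2
      rcases lt_trichotomy (σ i) (σ j) with hlt | heq | hlt
      · exact ⟨σ i, σ j, hlt, by omega, by simp, by simp⟩
      · exact absurd (σ.injective heq) hij.ne
      · rw [Fin.lt_def] at hlt
        exact ⟨σ i, σ j + n, by omega, by omega, by simp, by
          apply Fin.ext; simp [Nat.mod_eq_of_lt h2]⟩
    have hf := hfloor s t hst hts
    rw [hs, ht, σ.symm_apply_apply, σ.symm_apply_apply] at hf
    have := le_sub_of_steps step hcut s t hst hts (by omega)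
    simp only [hE, hs, ht, σ.symm_apply_apply] at this
    rwa [hf]
  exact key.trans (le_abs_self _)

theorem gap_le_of_inDilate {n m : ℕ} [NeZero n] (hn : 2 ≤ n) {x : affineSymm n} {c : Fin n → ℤ}
    (hc : ∀ j, ((x⁻¹.1 0 : V n) : Fin n → ℝ) j = c j) {p : V n} (hp : InBase (p : Fin n → ℝ))
    (hx : StrictAnti ((x.1 p : V n) : Fin n → ℝ)) (hm : InDilate m c) {y : V n}
    (hy : y ∈ shiClass m (x.1 p)) (i j : Fin n) :
    gap ((x.1 p : V n) : Fin n → ℝ) i j ≤ gap (y : Fin n → ℝ) i j := by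
  unfold gap
  split_ifs with h1 h2
  · obtain ⟨h0, h⟩ := floor_le_of_inDilate hn hc hp hx hm hy h1
    rwa [abs_of_nonneg h0]
  · obtain ⟨h0, h⟩ := floor_le_of_inDilate hn hc hp hx hm hy h2
    rwa [abs_of_nonneg h0]
  · exact le_rfl

/-- A dominant alcove `x A₀` is `m`-minimal if and only if `x⁻¹ 0` lies in the dilated simplex. -/
theorem isMMinimal_alcove_iff {n m : ℕ} [NeZero n] (hn : 2 ≤ n) {x : affineSymm n}
    {c : Fin n → ℤ} (hc : ∀ j, ((x⁻¹.1 0 : V n) : Fin n → ℝ) j = c j) {p : V n}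
    (hp : InBase (p : Fin n → ℝ)) (hx : StrictAnti ((x.1 p : V n) : Fin n → ℝ)) :
    IsMMinimal n m (alcove n x) ↔ InDilate m c := by
  have hsg := (isGeneric_apply hn x hp.isGeneric).shiGeneric m
  constructor
  · rintro ⟨R, hR, w, hw, hAR, hmin⟩ i
    by_contra hi
    obtain ⟨h1, h2⟩ := exists_shorter hn hc hp hx hi
    have := alcove_injective hn hw
    subst this
    rw [← hR.eq_shiClass (hAR (apply_mem_alcove hn x hp)),
      ← alcove_subset_shiRegion_iff hn hR _ hp] at h1
    exact absurd (hmin _ h1) (not_le.mpr h2)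
  · intro hm
    have hR := isShiRegion_shiClass hsg
    refine ⟨_, hR, x, rfl,
      (alcove_subset_shiRegion_iff hn hR x hp).mpr (self_mem_shiClass hsg), fun w' hw' => ?_⟩
    rw [alcove_subset_shiRegion_iff hn hR w' hp] at hw'
    have h1 := two_mul_wordLength hn x hp
    have h2 := two_mul_wordLength hn w' hp
    have h3 : gapSum ((x.1 p : V n) : Fin n → ℝ) ≤ gapSum ((w'.1 p : V n) : Fin n → ℝ) :=
      Finset.sum_le_sum fun y _ => gap_le_of_inDilate hn hc hp hx hm hw' y.1 y.2
    omega

theorem exists_int_apply_zero {n : ℕ} [NeZero n] (hn : 2 ≤ n) (w : affineSymm n) :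
    ∃ c : Fin n → ℤ, ∀ j, ((w.1 0 : V n) : Fin n → ℝ) j = c j := by
  obtain ⟨σ, z, h⟩ := exists_perm hn w
  exact ⟨z, fun j => by rw [h]; simp⟩

theorem IsDominantShiRegion.strictAnti {n m : ℕ} [NeZero n] (hn : 2 ≤ n) {R : Set (V n)}
    (hR : IsDominantShiRegion n m R) {w : affineSymm n} (hw : alcove n w ⊆ R) {p : V n}
    (hp : InBase (p : Fin n → ℝ)) : StrictAnti ((w.1 p : V n) : Fin n → ℝ) :=
  (alcove_subset_dominantChamber_iff hn hp).mp (hw.trans hR.2)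

/-- Each dominant region contains exactly one minimal alcove. -/
theorem existsUnique_isMMinimal {n m : ℕ} [NeZero n] (hn : 2 ≤ n) {R : Set (V n)}
    (hR : IsDominantShiRegion n m R) : ∃! A, IsMMinimal n m A ∧ A ⊆ R := by
  obtain ⟨p, hp⟩ := exists_inBase n
  obtain ⟨x, hxR, hmin⟩ := exists_minimalFor_of_wellFoundedLT (fun w => alcove n w ⊆ R)
    (wordLength n) (exists_alcove_subset hn hR.1)
  have hxmin : IsMMinimal n m (alcove n x) :=
    ⟨R, hR.1, x, rfl, hxR, fun w' hw' => (le_total _ _).elim id (hmin hw')⟩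
  refine ⟨alcove n x, ⟨hxmin, hxR⟩, ?_⟩
  rintro A ⟨⟨R', hR', w, rfl, hwR', hwmin⟩, hwR⟩
  have hwp := apply_mem_alcove hn w hp
  have hRR : R' = R := (hR'.eq_shiClass (hwR' hwp)).trans (hR.1.eq_shiClass (hwR hwp)).symm
  subst hRR
  -- the gaps of `w A₀` are at least those of `x A₀`, with the same sum
  obtain ⟨c, hc⟩ := exists_int_apply_zero hn x⁻¹
  have hx := hR.strictAnti hn hxR hp
  have hw := hR.strictAnti hn hwR hp
  have hdil := (isMMinimal_alcove_iff hn hc hp hx).mp hxmin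
  have hxp := apply_mem_alcove hn x hp
  have hwx : w.1 p ∈ shiClass m (x.1 p) := by
    rw [← hR.1.eq_shiClass (hxR hxp)]; exact hwR hwp
  have hlen : gapSum ((x.1 p : V n) : Fin n → ℝ) = gapSum ((w.1 p : V n) : Fin n → ℝ) := by
    rw [← two_mul_wordLength hn x hp, ← two_mul_wordLength hn w hp,
      le_antisymm (hwmin x hxR) (le_of_eq_of_le rfl
        ((le_total _ _).elim id (hmin hwR)))]
  have heq := (Finset.sum_eq_sum_iff_of_le fun y _ =>
    gap_le_of_inDilate hn hc hp hx hdil hwx y.1 y.2).mp hlen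
  have hmem : w.1 p ∈ alcove n x := by
    refine (mem_alcove_iff_floor hn hxp).mpr ⟨isGeneric_apply hn w hp.isGeneric, ?_⟩
    intro i j hij
    have h1 := heq (i, j) (Finset.mem_univ _)
    simp only [gap, if_pos hij] at h1
    rw [abs_of_nonneg (Int.floor_nonneg.mpr (by linarith [hx hij])),
      abs_of_nonneg (Int.floor_nonneg.mpr (by linarith [hw hij]))] at h1
    exact h1.symm
  rw [eq_of_mem_alcove hn hwp hmem]

/-- A dominant minimal alcove lies in exactly one dominant region. -/
theorem existsUnique_isDominantShiRegion {n m : ℕ} [NeZero n] (hn : 2 ≤ n) (hm : 1 ≤ m)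
    {A : Set (V n)} (hA : IsMMinimal n m A) (hAd : A ⊆ dominantChamber n) :
    ∃! R, IsDominantShiRegion n m R ∧ A ⊆ R := by
  obtain ⟨R, hR, w, rfl, hwR, -⟩ := hA
  obtain ⟨p, hp⟩ := exists_inBase n
  have hwp := apply_mem_alcove hn w hp
  refine ⟨R, ⟨⟨hR, ?_⟩, hwR⟩, ?_⟩
  · rw [hR.eq_shiClass (hwR hwp)]
    exact shiClass_subset_dominantChamber hm ((alcove_subset_dominantChamber_iff hn hp).mp hAd)
  · rintro R' ⟨⟨hR', -⟩, hwR'⟩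
    exact (hR'.eq_shiClass (hwR' hwp)).trans (hR.eq_shiClass (hwR hwp)).symm

/-! ### Bead sets of partitions -/

/-- The position of the bead of row `x`: beads sit at the vertical steps of the boundary path. -/
def bead (μ : YoungDiagram) (x : ℕ) : ℤ := μ.rowLen x - x - 1

/-- There is a bead at the position `z`. -/
def IsBead (μ : YoungDiagram) (z : ℤ) : Prop := ∃ x, bead μ x = z

theorem bead_strictAnti (μ : YoungDiagram) : StrictAnti (bead μ) := by
  intro x y h
  have := μ.rowLen_anti x y h.le
  unfold bead
  omega

/-- The positions without a bead belong to the horizontal steps of the boundary path. -/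
theorem not_isBead_iff {μ : YoungDiagram} {z : ℤ} :
    ¬ IsBead μ z ↔ ∃ y : ℕ, (y : ℤ) - μ.colLen y = z := by
  constructor
  · intro h
    -- the first row `x` whose bead is below `z` meets the column `z + x` in question
    have hex : ∃ x, bead μ x < z := by
      refine ⟨μ.colLen 0 + z.natAbs, ?_⟩
      have : μ.rowLen (μ.colLen 0 + z.natAbs) = 0 := by
        by_contra h0
        have h1 := YoungDiagram.mem_iff_lt_rowLen.mpr (Nat.pos_of_ne_zero h0)
        rw [YoungDiagram.mem_iff_lt_colLen] at h1
        omega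
      unfold bead
      omega
    classical
    have h1 := Nat.find_spec hex
    set x := Nat.find hex with hx
    unfold bead at h1
    refine ⟨(z + x).toNat, ?_⟩
    have hy : (((z + x).toNat : ℕ) : ℤ) = z + x := by omega
    suffices μ.colLen (z + x).toNat = x by omega
    apply le_antisymm
    · by_contra hlt
      have h2 := YoungDiagram.mem_iff_lt_colLen.mpr (not_le.mp hlt)
      rw [YoungDiagram.mem_iff_lt_rowLen] at h2
      omega
    · rcases Nat.eq_zero_or_pos x with h0 | h0
      · omega
      · have h2 : ¬ bead μ (x - 1) < z := Nat.find_min hex (by omega)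
        have h3 : bead μ (x - 1) ≠ z := fun h' => h ⟨_, h'⟩
        unfold bead at h2 h3
        have h4 : (x - 1, (z + x).toNat) ∈ μ := by
          rw [YoungDiagram.mem_iff_lt_rowLen]
          omega
        rw [YoungDiagram.mem_iff_lt_colLen] at h4
        omega
  · rintro ⟨y, hy⟩ ⟨x, hx⟩
    unfold bead at hx
    by_cases h : (x, y) ∈ μ
    · have h1 := YoungDiagram.mem_iff_lt_rowLen.mp h
      have h2 := YoungDiagram.mem_iff_lt_colLen.mp h
      omega
    · have h1 : ¬ y < μ.rowLen x := fun h' => h (YoungDiagram.mem_iff_lt_rowLen.mpr h')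
      have h2 : ¬ x < μ.colLen y := fun h' => h (YoungDiagram.mem_iff_lt_colLen.mpr h')
      omega

theorem hookLength_eq {μ : YoungDiagram} {x y : ℕ} (h : (x, y) ∈ μ) :
    (hookLength μ (x, y) : ℤ) = bead μ x - ((y : ℤ) - μ.colLen y) := by
  have h1 := YoungDiagram.mem_iff_lt_rowLen.mp h
  have h2 := YoungDiagram.mem_iff_lt_colLen.mp h
  simp only [hookLength, bead]
  omega

/-- Hook lengths are the distances from a bead down to an empty position, so that a partition is a
`t`-core if and only if its beads can be moved down by `t`. -/
theorem isCore_iff {t : ℕ} (ht : 0 < t) {μ : YoungDiagram} :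
    IsCore t μ ↔ ∀ z, IsBead μ z → IsBead μ (z - t) := by
  constructor
  · rintro h z ⟨x, rfl⟩
    by_contra hz
    obtain ⟨y, hy⟩ := not_isBead_iff.mp hz
    have hmem : (x, y) ∈ μ := by
      by_contra h'
      have h1 : ¬ y < μ.rowLen x := fun h'' => h' (YoungDiagram.mem_iff_lt_rowLen.mpr h'')
      have h2 : ¬ x < μ.colLen y := fun h'' => h' (YoungDiagram.mem_iff_lt_colLen.mpr h'')
      unfold bead at hy
      omega
    refine h (x, y) hmem ?_
    have := hookLength_eq hmem
    have : hookLength μ (x, y) = t := by omega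
    rw [this]
  · rintro h ⟨x, y⟩ hmem ⟨k, hk⟩
    have hdown : ∀ k : ℕ, IsBead μ (bead μ x - t * k) := by
      intro k
      induction k with
      | zero => exact ⟨x, by simp⟩
      | succ k ih =>
        have := h _ ih
        convert this using 1
        push_cast
        ring
    refine not_isBead_iff.mpr ⟨y, ?_⟩ (hdown k)
    have h1 := hookLength_eq hmem
    rw [hk] at h1
    push_cast at h1
    omega

theorem eq_of_isBead_iff {μ ν : YoungDiagram} (h : ∀ z, IsBead μ z ↔ IsBead ν z) : μ = ν := by
  have h1 : Set.range (fun x => - bead μ x) = Set.range (fun x => - bead ν x) := by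
    ext z
    have : ∀ μ, z ∈ Set.range (fun x => - bead μ x) ↔ IsBead μ (-z) := fun μ =>
      exists_congr fun x => neg_eq_iff_eq_neg
    rw [this, this, h]
  have h2 := (StrictMono.range_inj (fun x y hxy => neg_lt_neg (bead_strictAnti μ hxy))
    (fun x y hxy => neg_lt_neg (bead_strictAnti ν hxy))).mp h1
  have h3 : ∀ x, μ.rowLen x = ν.rowLen x := fun x => by
    have := congrFun h2 x
    simp only [bead] at this
    omega
  ext ⟨x, y⟩
  rw [YoungDiagram.mem_cells, YoungDiagram.mem_cells, YoungDiagram.mem_iff_lt_rowLen,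
    YoungDiagram.mem_iff_lt_rowLen, h3]

theorem isBead_add_one_iff {μ : YoungDiagram} {x : ℕ} :
    IsBead μ (bead μ x + 1) ↔ 0 < x ∧ μ.rowLen (x - 1) = μ.rowLen x := by
  constructor
  · rintro ⟨y, hy⟩
    have h1 : y < x := (bead_strictAnti μ).lt_iff_gt.mp (by omega)
    have h2 : ¬ y < x - 1 := fun h => by
      have e1 := bead_strictAnti μ h
      have e2 := bead_strictAnti μ (show x - 1 < x by omega)
      omega
    obtain rfl : y = x - 1 := by omega
    unfold bead at hy
    exact ⟨by omega, by omega⟩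
  · rintro ⟨h1, h2⟩
    exact ⟨x - 1, by unfold bead; omega⟩

theorem isBead_sub_one_iff {μ : YoungDiagram} {x : ℕ} :
    IsBead μ (bead μ x - 1) ↔ μ.rowLen (x + 1) = μ.rowLen x := by
  constructor
  · rintro ⟨y, hy⟩
    have h1 : x < y := (bead_strictAnti μ).lt_iff_gt.mp (by omega)
    have h2 : ¬ x + 1 < y := fun h => by
      have e1 := bead_strictAnti μ h
      have e2 := bead_strictAnti μ (Nat.lt_succ_self x)
      simp only [Nat.succ_eq_add_one] at e2
      omega
    obtain rfl : y = x + 1 := by omega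
    unfold bead at hy
    omega
  · intro h
    exact ⟨x + 1, by unfold bead; omega⟩

/-- A box can be added at the end of row `x` if the bead of that row can move up by one. -/
theorem mem_addable_iff {n : ℕ} {i : Fin n} {μ : YoungDiagram} {x y : ℕ} :
    (x, y) ∈ addable n i μ ↔ y = μ.rowLen x ∧ ¬ IsBead μ (bead μ x + 1) ∧
      ((bead μ x + 1 : ℤ) : ZMod n) = ((i : ℕ) : ZMod n) := by
  have hres : y = μ.rowLen x → residue n (x, y) = ((bead μ x + 1 : ℤ) : ZMod n) := by
    rintro rfl
    simp [residue, bead]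
  have hcorner : (x, y) ∉ μ ∧ IsLowerSet (insert (x, y) (μ : Set (ℕ × ℕ))) ↔
      y = μ.rowLen x ∧ ¬ IsBead μ (bead μ x + 1) := by
    rw [isBead_add_one_iff]
    have hm : ∀ a b : ℕ, (a, b) ∈ insert (x, y) (μ : Set (ℕ × ℕ)) ↔
        (a = x ∧ b = y) ∨ b < μ.rowLen a := fun a b => by
      rw [Set.mem_insert_iff, Prod.mk.injEq, SetLike.mem_coe, YoungDiagram.mem_iff_lt_rowLen]
    constructor
    · rintro ⟨h1, h2⟩
      rw [YoungDiagram.mem_iff_lt_rowLen] at h1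
      have h3 := (hm _ _).mp (h2 (show (x, μ.rowLen x) ≤ (x, y) from ⟨le_rfl, by simpa using h1⟩)
        ((hm x y).mpr (Or.inl ⟨rfl, rfl⟩)))
      have h4 := (hm _ _).mp (h2 (show (x - 1, y) ≤ (x, y) from ⟨by simp, le_rfl⟩)
        ((hm x y).mpr (Or.inl ⟨rfl, rfl⟩)))
      omega
    · rintro ⟨rfl, h⟩
      refine ⟨by simp [YoungDiagram.mem_iff_lt_rowLen], ?_⟩
      rintro ⟨a, b⟩ ⟨a', b'⟩ ⟨hle1, hle2⟩ hab
      simp only at hle1 hle2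
      rw [hm] at hab ⊢
      rcases hab with ⟨rfl, rfl⟩ | hab
      · rcases hle1.eq_or_lt with rfl | hlt
        · omega
        · have e1 := μ.rowLen_anti a' (a - 1) (by omega)
          have e2 := μ.rowLen_anti (a - 1) a (by omega)
          omega
      · have := μ.rowLen_anti a' a hle1
        omega
  constructor
  · rintro ⟨h1, h2, h3⟩
    obtain ⟨h4, h5⟩ := hcorner.mp ⟨h1, h2⟩
    exact ⟨h4, h5, by rw [← hres h4, h3]⟩
  · rintro ⟨h1, h2, h3⟩
    obtain ⟨h4, h5⟩ := hcorner.mpr ⟨h1, h2⟩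
    exact ⟨h4, h5, by rw [hres h1, h3]⟩

/-- The last box of row `x` can be removed if the bead of that row can move down by one. -/
theorem mem_removable_iff {n : ℕ} {i : Fin n} {μ : YoungDiagram} {x y : ℕ} :
    (x, y) ∈ removable n i μ ↔ y + 1 = μ.rowLen x ∧ ¬ IsBead μ (bead μ x - 1) ∧
      ((bead μ x : ℤ) : ZMod n) = ((i : ℕ) : ZMod n) := by
  have hres : y + 1 = μ.rowLen x → residue n (x, y) = ((bead μ x : ℤ) : ZMod n) := by
    intro h
    simp only [residue, bead, ← h]
    push_cast
    ring
  have hcorner : (x, y) ∈ μ ∧ IsLowerSet ((μ : Set (ℕ × ℕ)) \ {(x, y)}) ↔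
      y + 1 = μ.rowLen x ∧ ¬ IsBead μ (bead μ x - 1) := by
    rw [isBead_sub_one_iff]
    have hm : ∀ a b : ℕ, (a, b) ∈ (μ : Set (ℕ × ℕ)) \ {(x, y)} ↔
        b < μ.rowLen a ∧ ¬ (a = x ∧ b = y) := fun a b => by
      rw [Set.mem_sdiff, Set.mem_singleton_iff, Prod.mk.injEq, SetLike.mem_coe,
        YoungDiagram.mem_iff_lt_rowLen]
    constructor
    · rintro ⟨h1, h2⟩
      rw [YoungDiagram.mem_iff_lt_rowLen] at h1
      have h3 : ¬ y + 1 < μ.rowLen x := fun h =>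
        ((hm _ _).mp (h2 (show (x, y) ≤ (x, y + 1) from ⟨le_rfl, by simp⟩)
          ((hm x (y + 1)).mpr ⟨h, by omega⟩))).2 ⟨rfl, rfl⟩
      have h4 : ¬ y < μ.rowLen (x + 1) := fun h =>
        ((hm _ _).mp (h2 (show (x, y) ≤ (x + 1, y) from ⟨by simp, le_rfl⟩)
          ((hm (x + 1) y).mpr ⟨h, by omega⟩))).2 ⟨rfl, rfl⟩
      omega
    · rintro ⟨h1, h2⟩
      refine ⟨YoungDiagram.mem_iff_lt_rowLen.mpr (by omega), ?_⟩
      rintro ⟨a, b⟩ ⟨a', b'⟩ ⟨hle1, hle2⟩ hab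
      simp only at hle1 hle2
      rw [hm] at hab ⊢
      have e1 := μ.rowLen_anti a' a hle1
      refine ⟨by omega, ?_⟩
      rintro ⟨rfl, rfl⟩
      have e2 := μ.rowLen_anti a' (a' + 1) (by omega)
      rcases hle1.eq_or_lt with rfl | hlt
      · omega
      · have e3 := μ.rowLen_anti (a' + 1) a hlt
        omega
  constructor
  · rintro ⟨h1, h2, h3⟩
    obtain ⟨h4, h5⟩ := hcorner.mp ⟨h1, h2⟩
    exact ⟨h4, h5, by rw [← hres h4, h3]⟩
  · rintro ⟨h1, h2, h3⟩
    obtain ⟨h4, h5⟩ := hcorner.mpr ⟨h1, h2⟩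
    exact ⟨h4, h5, by rw [hres h1, h3]⟩

/-! ### Adding and removing boxes of a core -/

/-- The involution of `ℤ` that exchanges each position of residue `i` with the one below it. -/
def swapResidue {n : ℕ} (i : Fin n) (z : ℤ) : ℤ :=
  if (z : ZMod n) = ((i : ℕ) : ZMod n) then z - 1
  else if ((z + 1 : ℤ) : ZMod n) = ((i : ℕ) : ZMod n) then z + 1 else z

theorem isBead_of_le {n : ℕ} (hn : 0 < n) {μ : YoungDiagram} (hμ : IsCore n μ) {z z' : ℤ}
    (hz : IsBead μ z) (hle : z' ≤ z) (hmod : (z' : ZMod n) = (z : ZMod n)) : IsBead μ z' := by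
  obtain ⟨k, hk⟩ := (ZMod.intCast_eq_intCast_iff_dvd_sub z' z n).mp hmod
  have hk0 : 0 ≤ k := by
    by_contra h
    have hn' : (0 : ℤ) < n := by exact_mod_cast hn
    nlinarith
  obtain ⟨j, rfl⟩ := Int.eq_ofNat_of_zero_le hk0
  clear hmod hle
  induction j generalizing z with
  | zero =>
    have : z' = z := by simp at hk; omega
    rwa [this]
  | succ j ih =>
    refine ih ((isCore_iff hn).mp hμ z hz) ?_ (by omega)
    push_cast at hk
    linarith

/-- A core does not have both addable and removable boxes of the same residue. -/
theorem isBead_sub_one_of_addable {n : ℕ} (hn : 0 < n) {μ : YoungDiagram} (hμ : IsCore n μ)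
    {i : Fin n} (ha : (addable n i μ).Nonempty) {z : ℤ} (hz : IsBead μ z)
    (hi : (z : ZMod n) = ((i : ℕ) : ZMod n)) : IsBead μ (z - 1) := by
  obtain ⟨⟨x, y⟩, hxy⟩ := ha
  obtain ⟨-, h1, h2⟩ := mem_addable_iff.mp hxy
  have hlt : z < bead μ x + 1 := by
    by_contra h
    exact h1 (isBead_of_le hn hμ hz (not_lt.mp h) (h2.trans hi.symm))
  refine isBead_of_le hn hμ ⟨x, rfl⟩ (by omega) ?_
  have := h2.trans hi.symm
  push_cast at this ⊢
  rw [← this]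
  ring

theorem exists_coe_eq {S : Set (ℕ × ℕ)} (hS : IsLowerSet S) (hf : S.Finite) :
    ∃ ν : YoungDiagram, (ν : Set (ℕ × ℕ)) = S :=
  ⟨⟨hf.toFinset, by simpa using hS⟩, by ext; simp⟩

/-- The rule `s_i` on cores is well defined and exchanges the residues `i - 1` and `i` of the
beads. -/
theorem exists_moveBoxes {n : ℕ} (hn : 2 ≤ n) {μ : YoungDiagram} (hμ : IsCore n μ) (i : Fin n) :
    ∃ ν : YoungDiagram, (ν : Set (ℕ × ℕ)) = moveBoxes n i μ ∧
      ∀ z, IsBead ν z ↔ IsBead μ (swapResidue i z) := by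
  have hn0 : 0 < n := by omega
  have : Fact (1 < n) := ⟨by omega⟩
  have hres : ∀ z : ℤ, (z : ZMod n) = ((i : ℕ) : ZMod n) →
      ((z + 1 : ℤ) : ZMod n) ≠ ((i : ℕ) : ZMod n) := by
    intro z h1 h2
    rw [Int.cast_add, h1, Int.cast_one] at h2
    exact one_ne_zero (add_eq_left.mp h2)
  classical
  by_cases ha : (addable n i μ).Nonempty
  · have hlow : IsLowerSet ((μ : Set (ℕ × ℕ)) ∪ addable n i μ) := by
      rintro a b hba (h | h)
      · exact Or.inl (μ.isLowerSet hba h)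
      · rcases h.2.1 hba (Set.mem_insert _ _) with rfl | h'
        · exact Or.inr h
        · exact Or.inl h'
    have hfin : ((μ : Set (ℕ × ℕ)) ∪ addable n i μ).Finite := by
      refine Set.Finite.union μ.cells.finite_toSet ?_
      refine ((Set.finite_Iic (μ.colLen 0)).image fun x => (x, μ.rowLen x)).subset ?_
      rintro ⟨x, y⟩ hxy
      obtain ⟨h1, h2, -⟩ := mem_addable_iff.mp hxy
      refine ⟨x, ?_, by rw [h1]⟩
      by_contra hx
      have hx : μ.colLen 0 < x := not_le.mp hx
      have hzero : ∀ x, μ.colLen 0 ≤ x → μ.rowLen x = 0 := fun x hx => by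
        by_contra h0
        have h1 := YoungDiagram.mem_iff_lt_rowLen.mpr (Nat.pos_of_ne_zero h0)
        rw [YoungDiagram.mem_iff_lt_colLen] at h1
        omega
      exact h2 (isBead_add_one_iff.mpr ⟨by omega, by
        rw [hzero x (by omega), hzero (x - 1) (by omega)]⟩)
    obtain ⟨ν, hν⟩ := exists_coe_eq hlow hfin
    refine ⟨ν, by rw [hν, moveBoxes, if_pos ha], ?_⟩
    have hmem : ∀ x y, y < ν.rowLen x ↔ y < μ.rowLen x ∨ (y = μ.rowLen x ∧
        ¬ IsBead μ (bead μ x + 1) ∧ ((bead μ x + 1 : ℤ) : ZMod n) = ((i : ℕ) : ZMod n)) := by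
      intro x y
      rw [← mem_addable_iff, ← YoungDiagram.mem_iff_lt_rowLen, ← YoungDiagram.mem_iff_lt_rowLen,
        ← SetLike.mem_coe, hν]
      rfl
    have hmove : ∀ x, ¬ IsBead μ (bead μ x + 1) →
        ((bead μ x + 1 : ℤ) : ZMod n) = ((i : ℕ) : ZMod n) → bead ν x = bead μ x + 1 := by
      intro x h1 h2
      have e1 := (hmem x (μ.rowLen x)).mpr (Or.inr ⟨rfl, h1, h2⟩)
      have e2 := mt (hmem x (μ.rowLen x + 1)).mp (by omega)
      unfold bead
      omega
    have hstay : ∀ x, ¬ (¬ IsBead μ (bead μ x + 1) ∧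
        ((bead μ x + 1 : ℤ) : ZMod n) = ((i : ℕ) : ZMod n)) → bead ν x = bead μ x := by
      intro x h
      have e1 := mt (hmem x (μ.rowLen x)).mp (by rintro (h' | h'); exacts [by omega, h h'.2])
      have e2 : ¬ ν.rowLen x < μ.rowLen x := fun h' =>
        absurd ((hmem x (ν.rowLen x)).mpr (Or.inl h')) (lt_irrefl _)
      unfold bead
      omega
    have hdown := fun z => isBead_sub_one_of_addable hn0 hμ ha (z := z)
    intro z
    unfold swapResidue
    constructor
    · rintro ⟨x, rfl⟩
      by_cases h : ¬ IsBead μ (bead μ x + 1) ∧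
          ((bead μ x + 1 : ℤ) : ZMod n) = ((i : ℕ) : ZMod n)
      · rw [hmove x h.1 h.2, if_pos h.2]
        exact ⟨x, by ring⟩
      · rw [hstay x h]
        split_ifs with h1 h2
        · exact hdown _ ⟨x, rfl⟩ h1
        · by_contra h3
          exact h ⟨h3, h2⟩
        · exact ⟨x, rfl⟩
    · split_ifs with h1 h2
      · intro h
        by_cases hz : IsBead μ z
        · obtain ⟨x, rfl⟩ := hz
          exact ⟨x, hstay x fun h' => hres _ h1 h'.2⟩
        · obtain ⟨x, hx⟩ := h
          have hx' : bead μ x + 1 = z := by omega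
          exact ⟨x, by rw [hmove x (by rwa [hx']) (by rwa [hx']), hx']⟩
      · intro h
        have hz := hdown _ h h2
        rw [add_sub_cancel_right] at hz
        obtain ⟨x, rfl⟩ := hz
        exact ⟨x, hstay x fun h' => h'.1 h⟩
      · rintro ⟨x, rfl⟩
        exact ⟨x, hstay x fun h' => h2 h'.2⟩
  · have hset : moveBoxes n i μ = (μ : Set (ℕ × ℕ)) \ removable n i μ := by
      rw [moveBoxes, if_neg ha]
      split_ifs with hr
      · rfl
      · rw [Set.not_nonempty_iff_eq_empty.mp hr, Set.sdiff_empty]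
    have hlow : IsLowerSet ((μ : Set (ℕ × ℕ)) \ removable n i μ) := by
      rintro a b hba ⟨h1, h2⟩
      refine ⟨μ.isLowerSet hba h1, fun h3 => ?_⟩
      by_cases hab : a = b
      · exact h2 (hab ▸ h3)
      · exact (h3.2.1 hba ⟨h1, hab⟩).2 rfl
    obtain ⟨ν, hν⟩ := exists_coe_eq hlow (μ.cells.finite_toSet.subset Set.sdiff_subset)
    refine ⟨ν, by rw [hν, hset], ?_⟩
    have hmem : ∀ x y, y < ν.rowLen x ↔ y < μ.rowLen x ∧ ¬ (y + 1 = μ.rowLen x ∧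
        ¬ IsBead μ (bead μ x - 1) ∧ ((bead μ x : ℤ) : ZMod n) = ((i : ℕ) : ZMod n)) := by
      intro x y
      rw [← mem_removable_iff, ← YoungDiagram.mem_iff_lt_rowLen, ← YoungDiagram.mem_iff_lt_rowLen,
        ← SetLike.mem_coe, hν]
      rfl
    have hmove : ∀ x, ¬ IsBead μ (bead μ x - 1) →
        ((bead μ x : ℤ) : ZMod n) = ((i : ℕ) : ZMod n) → bead ν x = bead μ x - 1 := by
      intro x h1 h2
      have h0 : 0 < μ.rowLen x := by
        by_contra h0
        rw [isBead_sub_one_iff] at h1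
        have := μ.rowLen_anti x (x + 1) (by omega)
        omega
      have e1 := mt (hmem x (μ.rowLen x - 1)).mp (fun h => h.2 ⟨by omega, h1, h2⟩)
      have e2 : ¬ ν.rowLen x < μ.rowLen x - 1 := fun h' =>
        absurd ((hmem x (ν.rowLen x)).mpr ⟨by omega, by omega⟩) (lt_irrefl _)
      unfold bead
      omega
    have hstay : ∀ x, ¬ (¬ IsBead μ (bead μ x - 1) ∧
        ((bead μ x : ℤ) : ZMod n) = ((i : ℕ) : ZMod n)) → bead ν x = bead μ x := by
      intro x h
      have e1 := mt (hmem x (μ.rowLen x)).mp (by omega)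
      have e2 : ¬ ν.rowLen x < μ.rowLen x := fun h' =>
        absurd ((hmem x (ν.rowLen x)).mpr ⟨h', fun h'' => h h''.2⟩) (lt_irrefl _)
      unfold bead
      omega
    -- since nothing can be added, a bead just below a position of residue `i` comes with a bead
    -- at that position
    have hup : ∀ z, IsBead μ z → ((z + 1 : ℤ) : ZMod n) = ((i : ℕ) : ZMod n) →
        IsBead μ (z + 1) := by
      rintro z ⟨x, rfl⟩ h
      by_contra h'
      exact ha ⟨(x, μ.rowLen x), mem_addable_iff.mpr ⟨rfl, h', h⟩⟩
    have hpred : ∀ z : ℤ, (z : ZMod n) = ((i : ℕ) : ZMod n) → IsBead μ (z - 1) → IsBead μ z :=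
      fun z h1 h2 => by
        have := hup _ h2 (by rwa [sub_add_cancel])
        rwa [sub_add_cancel] at this
    intro z
    unfold swapResidue
    constructor
    · rintro ⟨x, rfl⟩
      by_cases h : ¬ IsBead μ (bead μ x - 1) ∧ ((bead μ x : ℤ) : ZMod n) = ((i : ℕ) : ZMod n)
      · rw [hmove x h.1 h.2, sub_add_cancel, if_neg (fun h' => hres _ h' (by
          rw [sub_add_cancel]; exact h.2)), if_pos h.2]
        exact ⟨x, rfl⟩
      · rw [hstay x h]
        split_ifs with h1 h2
        · by_contra h3
          exact h ⟨h3, h1⟩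
        · exact hup _ ⟨x, rfl⟩ h2
        · exact ⟨x, rfl⟩
    · split_ifs with h1 h2
      · intro h
        obtain ⟨x, rfl⟩ := hpred z h1 h
        exact ⟨x, hstay x fun h' => h'.1 h⟩
      · rintro ⟨x, hx⟩
        by_cases hz : IsBead μ z
        · obtain ⟨x', rfl⟩ := hz
          exact ⟨x', hstay x' fun h' => h1 h'.2⟩
        · exact ⟨x, by
            rw [hmove x (by rwa [hx, add_sub_cancel_right]) (by rwa [hx]), hx,
              add_sub_cancel_right]⟩
      · rintro ⟨x, rfl⟩
        exact ⟨x, hstay x fun h' => h1 h'.2⟩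

theorem swapResidue_sub {n : ℕ} (i : Fin n) (z : ℤ) :
    swapResidue i (z - n) = swapResidue i z - n := by
  have h1 : ((z - n : ℤ) : ZMod n) = (z : ZMod n) := by simp
  have h2 : ((z - n + 1 : ℤ) : ZMod n) = ((z + 1 : ℤ) : ZMod n) := by simp
  unfold swapResidue
  rw [h1, h2]
  split_ifs <;> ring

/-- The core `s_i μ`. -/
theorem exists_move {n : ℕ} (hn : 2 ≤ n) (μ : Core n) (i : Fin n) :
    ∃ ν : Core n, (((ν : Core n) : YoungDiagram) : Set (ℕ × ℕ)) = moveBoxes n i μ ∧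
      ∀ z, IsBead ν.1 z ↔ IsBead μ.1 (swapResidue i z) := by
  obtain ⟨ν, h1, h2⟩ := exists_moveBoxes hn μ.2 i
  refine ⟨⟨ν, ?_⟩, h1, h2⟩
  rw [isCore_iff (by omega)]
  intro z hz
  rw [h2] at hz ⊢
  rw [swapResidue_sub]
  exact (isCore_iff (by omega)).mp μ.2 _ hz

/-! ### The lattice vector of a core -/

/-- On each runner of a core, the beads fill up all positions below some bound. -/
theorem exists_runner {n : ℕ} [NeZero n] {μ : YoungDiagram} (hμ : IsCore n μ) (r : ℤ) :
    ∃ c : ℤ, ∀ k : ℤ, IsBead μ (r + n * k) ↔ k < c := by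
  have hn : 0 < n := Nat.pos_of_ne_zero (NeZero.ne n)
  have hn' : (1 : ℤ) ≤ n := by exact_mod_cast hn
  have hbdd : ∃ b : ℤ, ∀ k : ℤ, IsBead μ (r + n * k) → k ≤ b := by
    refine ⟨|bead μ 0| + |r|, ?_⟩
    rintro k ⟨x, hx⟩
    have h1 : bead μ x ≤ bead μ 0 := (bead_strictAnti μ).antitone (Nat.zero_le x)
    have h2 := le_abs_self (bead μ 0)
    have h3 := neg_abs_le r
    have h4 := abs_nonneg (bead μ 0)
    have h5 := abs_nonneg r
    by_contra hk
    nlinarith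
  have hinh : ∃ k : ℤ, IsBead μ (r + n * k) := by
    refine ⟨-(|r| + μ.colLen 0 + 1), ?_⟩
    have h1 := le_abs_self r
    have h2 := abs_nonneg r
    have h3 : r + n * -(|r| + μ.colLen 0 + 1) ≤ -1 - μ.colLen 0 := by nlinarith
    refine ⟨(-(r + n * -(|r| + μ.colLen 0 + 1)) - 1).toNat, ?_⟩
    have h4 : μ.rowLen (-(r + n * -(|r| + μ.colLen 0 + 1)) - 1).toNat = 0 := by
      by_contra h0
      have h1 := YoungDiagram.mem_iff_lt_rowLen.mpr (Nat.pos_of_ne_zero h0)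
      rw [YoungDiagram.mem_iff_lt_colLen] at h1
      omega
    unfold bead
    rw [h4]
    omega
  obtain ⟨c, hc, hmax⟩ := Int.exists_greatest_of_bdd hbdd hinh
  refine ⟨c + 1, fun k => ⟨fun h => by have := hmax k h; omega, fun h => ?_⟩⟩
  exact isBead_of_le hn hμ hc (by nlinarith) (by simp)

/-- The coordinate of residue `j` counts the beads on the runner of `j`, relative to the empty
partition. -/
noncomputable def coreVec {n : ℕ} [NeZero n] (μ : Core n) (j : Fin n) : ℤ :=
  (exists_runner μ.2 (j : ℕ)).choose

theorem isBead_iff_lt_coreVec {n : ℕ} [NeZero n] (μ : Core n) (j : Fin n) (k : ℤ) :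
    IsBead μ.1 ((j : ℕ) + n * k) ↔ k < coreVec μ j :=
  (exists_runner μ.2 (j : ℕ)).choose_spec k

theorem exists_position {n : ℕ} [NeZero n] (z : ℤ) :
    ∃ (j : Fin n) (k : ℤ), z = (j : ℕ) + n * k := by
  have hn : (0 : ℤ) < n := by exact_mod_cast Nat.pos_of_ne_zero (NeZero.ne n)
  have h1 := Int.emod_nonneg z hn.ne'
  have h2 := Int.emod_lt_of_pos z hn
  refine ⟨⟨(z % n).toNat, by omega⟩, z / n, ?_⟩
  have := Int.emod_add_mul_ediv z n
  simp only
  omega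

theorem coreVec_injective {n : ℕ} [NeZero n] : Function.Injective (coreVec (n := n)) := by
  intro μ ν h
  refine Subtype.ext (eq_of_isBead_iff fun z => ?_)
  obtain ⟨j, k, rfl⟩ := exists_position (n := n) z
  rw [isBead_iff_lt_coreVec, isBead_iff_lt_coreVec, h]

theorem coreVec_emptyCore {n : ℕ} [NeZero n] : coreVec (emptyCore n) = 0 := by
  funext j
  have hn : (0 : ℤ) < n := by exact_mod_cast Nat.pos_of_ne_zero (NeZero.ne n)
  have hb : ∀ z, IsBead (emptyCore n).1 z ↔ z < 0 := by
    intro z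
    have h0 : ∀ x, (emptyCore n).1.rowLen x = 0 := fun x => by
      by_contra h0
      exact YoungDiagram.notMem_bot _ (YoungDiagram.mem_iff_lt_rowLen.mpr (Nat.pos_of_ne_zero h0))
    constructor
    · rintro ⟨x, rfl⟩
      unfold bead
      rw [h0]
      omega
    · intro hz
      refine ⟨(-z - 1).toNat, ?_⟩
      unfold bead
      rw [h0]
      omega
  refine eq_of_forall_lt_iff fun k => ?_
  rw [← isBead_iff_lt_coreVec, hb, Pi.zero_apply]
  have hj : ((j : ℕ) : ℤ) < n := by exact_mod_cast j.2
  have hj0 : (0 : ℤ) ≤ ((j : ℕ) : ℤ) := by positivity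
  constructor
  · intro h
    by_contra hk
    nlinarith
  · intro h
    nlinarith

theorem natCast_fin_inj {n : ℕ} {i j : Fin n} :
    ((i : ℕ) : ZMod n) = ((j : ℕ) : ZMod n) ↔ i = j := by
  rw [ZMod.natCast_eq_natCast_iff', Nat.mod_eq_of_lt i.2, Nat.mod_eq_of_lt j.2, Fin.ext_iff]

theorem val_pred_int {n : ℕ} [NeZero n] (i : Fin n) :
    (((i - 1 : Fin n) : ℕ) : ℤ) = (i : ℕ) - 1 + n * shift i := by
  have h := val_pred i
  have hn := Nat.pos_of_ne_zero (NeZero.ne n)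
  unfold shift
  split_ifs at h ⊢ with h0
  · rw [h, h0]
    simp only [Fin.val_zero]
    omega
  · have : (i : ℕ) ≠ 0 := fun h => h0 (Fin.ext h)
    rw [h]
    omega

/-- `s_i` acts on the positions `j + n k` as it does on lattice vectors. -/
theorem swapResidue_position {n : ℕ} [NeZero n] (hn : 2 ≤ n) (i j : Fin n) (k : ℤ) :
    swapResidue i ((j : ℕ) + n * k) = (Equiv.swap (i - 1) i j : Fin n) +
      n * (k - (if j = i then shift i else if j = i - 1 then - shift i else 0)) := by
  have hp := val_pred_int i
  have hne := pred_ne hn i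
  have hpz : (((i - 1 : Fin n) : ℕ) : ZMod n) + 1 = ((i : ℕ) : ZMod n) := by
    have := congrArg (Int.cast : ℤ → ZMod n) hp
    push_cast at this
    rw [this]
    simp
  have h1 : ((((j : ℕ) + n * k : ℤ) : ZMod n) = ((i : ℕ) : ZMod n)) ↔ j = i := by
    push_cast
    rw [ZMod.natCast_self, zero_mul, add_zero, natCast_fin_inj]
  have h2 : ((((j : ℕ) + n * k + 1 : ℤ) : ZMod n) = ((i : ℕ) : ZMod n)) ↔ j = i - 1 := by
    push_cast
    rw [ZMod.natCast_self, zero_mul, add_zero, ← hpz, add_left_inj, natCast_fin_inj]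
  unfold swapResidue
  by_cases hj : j = i
  · rw [if_pos (h1.mpr hj), if_pos hj, hj, Equiv.swap_apply_right, hp]
    ring
  · rw [if_neg (mt h1.mp hj), if_neg hj]
    by_cases hj' : j = i - 1
    · rw [if_pos (h2.mpr hj'), if_pos hj', hj', Equiv.swap_apply_left, hp]
      ring
    · rw [if_neg (mt h2.mp hj'), if_neg hj', Equiv.swap_apply_of_ne_of_ne hj' hj]
      ring

theorem coreVec_move {n : ℕ} [NeZero n] (hn : 2 ≤ n) {μ ν : Core n} {i : Fin n}
    (h : ∀ z, IsBead ν.1 z ↔ IsBead μ.1 (swapResidue i z)) (j : Fin n) :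
    coreVec ν j = coreVec μ (Equiv.swap (i - 1) i j) +
      (if j = i then shift i else if j = i - 1 then - shift i else 0) := by
  refine eq_of_forall_lt_iff fun k => ?_
  rw [← isBead_iff_lt_coreVec, h, swapResidue_position hn, isBead_iff_lt_coreVec,
    sub_lt_iff_lt_add]

theorem sum_coreVec_move {n : ℕ} [NeZero n] (hn : 2 ≤ n) {μ ν : Core n} {i : Fin n}
    (h : ∀ z, IsBead ν.1 z ↔ IsBead μ.1 (swapResidue i z)) :
    ∑ j, coreVec ν j = ∑ j, coreVec μ j := by
  have hne := pred_ne hn i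
  rw [Finset.sum_congr rfl fun j _ => coreVec_move hn h j, Finset.sum_add_distrib,
    Equiv.sum_comp (Equiv.swap (i - 1) i) (coreVec μ)]
  have : ∀ j : Fin n, (if j = i then shift i else if j = i - 1 then - shift i else 0) =
      (if j = i then shift i else 0) + (if j = i - 1 then - shift i else 0) := fun j => by
    by_cases h1 : j = i
    · rw [if_pos h1, if_pos h1, if_neg (by rw [h1]; exact hne.symm), add_zero]
    · rw [if_neg h1, if_neg h1, zero_add]
  rw [Finset.sum_congr rfl fun j _ => this j, Finset.sum_add_distrib, Finset.sum_ite_eq',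
    Finset.sum_ite_eq']
  simp

/-- A nonempty core becomes smaller under some `s_i`. -/
theorem exists_move_card_lt {n : ℕ} [NeZero n] (hn : 2 ≤ n) {μ : Core n} (hμ : μ.1 ≠ ⊥) :
    ∃ (i : Fin n) (ν : Core n), ν.1.card < μ.1.card ∧
      ∀ z, IsBead ν.1 z ↔ IsBead μ.1 (swapResidue i z) := by
  have hcol : 0 < μ.1.colLen 0 := by
    by_contra h0
    apply hμ
    ext ⟨x, y⟩
    simp only [YoungDiagram.mem_cells, YoungDiagram.cells_bot, Finset.notMem_empty, iff_false]
    intro hxy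
    have := μ.1.up_left_mem (Nat.zero_le x) (Nat.zero_le y) hxy
    rw [YoungDiagram.mem_iff_lt_colLen] at this
    exact h0 this
  -- the last box of the last row can be removed
  set x := μ.1.colLen 0 - 1 with hx
  have h1 : 0 < μ.1.rowLen x := by
    rw [← YoungDiagram.mem_iff_lt_rowLen, YoungDiagram.mem_iff_lt_colLen]; omega
  have h2 : μ.1.rowLen (x + 1) = 0 := by
    by_contra h0
    have h1 := YoungDiagram.mem_iff_lt_rowLen.mpr (Nat.pos_of_ne_zero h0)
    rw [YoungDiagram.mem_iff_lt_colLen] at h1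
    omega
  have h3 : ¬ IsBead μ.1 (bead μ.1 x - 1) := by
    rw [isBead_sub_one_iff]; omega
  obtain ⟨i, k, hik⟩ := exists_position (n := n) (bead μ.1 x)
  have hi : ((bead μ.1 x : ℤ) : ZMod n) = ((i : ℕ) : ZMod n) := by rw [hik]; simp
  have hrem : (x, μ.1.rowLen x - 1) ∈ removable n i μ.1 :=
    mem_removable_iff.mpr ⟨by omega, h3, hi⟩
  have hadd : ¬ (addable n i μ.1).Nonempty := fun ha =>
    h3 (isBead_sub_one_of_addable (by omega) μ.2 ha ⟨x, rfl⟩ hi)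
  obtain ⟨ν, hν, hbead⟩ := exists_move hn μ i
  rw [moveBoxes, if_neg hadd, if_pos ⟨_, hrem⟩] at hν
  refine ⟨i, ν, Finset.card_lt_card ?_, hbead⟩
  rw [← Finset.coe_ssubset]
  change ((ν.1 : YoungDiagram) : Set (ℕ × ℕ)) ⊂ (μ.1 : Set (ℕ × ℕ))
  rw [hν]
  exact ⟨Set.sdiff_subset, fun hsub => (hsub hrem.1).2 hrem⟩

theorem sum_coreVec {n : ℕ} [NeZero n] (hn : 2 ≤ n) (μ : Core n) : ∑ j, coreVec μ j = 0 := by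
  induction hN : μ.1.card using Nat.strong_induction_on generalizing μ with
  | _ N ih =>
    by_cases hμ : μ.1 = ⊥
    · have : μ = emptyCore n := Subtype.ext hμ
      rw [this, coreVec_emptyCore]
      simp
    · obtain ⟨i, ν, hlt, hν⟩ := exists_move_card_lt hn hμ
      rw [← sum_coreVec_move hn hν]
      exact ih _ (hN ▸ hlt) ν rfl

/-- A core is also an `(m n + 1)`-core if and only if its vector lies in the dilated simplex. -/
theorem isCore_iff_inDilate {n : ℕ} [NeZero n] (m : ℕ) (μ : Core n) :
    IsCore (m * n + 1) μ.1 ↔ InDilate m (coreVec μ) := by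
  rw [isCore_iff (by omega)]
  have hpos : ∀ (i : Fin n) (k : ℤ), (i : ℕ) + n * k - ((m * n + 1 : ℕ) : ℤ) =
      ((i - 1 : Fin n) : ℕ) + n * (k - m - shift i) := by
    intro i k
    rw [val_pred_int]
    push_cast
    ring
  constructor
  · intro h i
    have h1 := h _ ((isBead_iff_lt_coreVec μ i (coreVec μ i - 1)).mpr (by omega))
    rw [hpos, isBead_iff_lt_coreVec] at h1
    omega
  · intro h z hz
    obtain ⟨i, k, rfl⟩ := exists_position (n := n) z
    rw [isBead_iff_lt_coreVec] at hz
    rw [hpos, isBead_iff_lt_coreVec]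
    have := h i
    omega

/-! ### The action on cores -/

/-- The vector of a core as a point of `V`. -/
noncomputable def corePoint {n : ℕ} [NeZero n] (hn : 2 ≤ n) (μ : Core n) : V n :=
  ⟨fun j => coreVec μ j, by
    change ∑ j, ((coreVec μ j : ℤ) : ℝ) = 0
    exact_mod_cast sum_coreVec hn μ⟩

theorem corePoint_apply {n : ℕ} [NeZero n] (hn : 2 ≤ n) (μ : Core n) (j : Fin n) :
    (corePoint hn μ : Fin n → ℝ) j = coreVec μ j := rfl

theorem corePoint_injective {n : ℕ} [NeZero n] (hn : 2 ≤ n) :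
    Function.Injective (corePoint (n := n) hn) := by
  intro μ ν h
  refine coreVec_injective (funext fun j => ?_)
  have : ((coreVec μ j : ℤ) : ℝ) = coreVec ν j := by
    rw [← corePoint_apply hn, h, corePoint_apply]
  exact_mod_cast this

theorem corePoint_emptyCore {n : ℕ} [NeZero n] (hn : 2 ≤ n) : corePoint hn (emptyCore n) = 0 :=
  V_ext fun j => by rw [corePoint_apply, coreVec_emptyCore]; simp

theorem corePoint_move {n : ℕ} [NeZero n] (hn : 2 ≤ n) {μ ν : Core n} {i : Fin n}
    (h : ∀ z, IsBead ν.1 z ↔ IsBead μ.1 (swapResidue i z)) :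
    corePoint hn ν = (gen n i).1 (corePoint hn μ) := by
  refine V_ext fun j => ?_
  rw [gen_apply, reflFun_apply hn, corePoint_apply, corePoint_apply, coreVec_move hn h]
  push_cast
  rfl

theorem exists_core_apply {n : ℕ} [NeZero n] (hn : 2 ≤ n) (w : affineSymm n) (μ : Core n) :
    ∃ ν : Core n, corePoint hn ν = w.1 (corePoint hn μ) := by
  induction w using affineSymm_induction with
  | one => exact ⟨μ, rfl⟩
  | gen_mul i w ih =>
    obtain ⟨ν, hν⟩ := ih
    obtain ⟨κ, -, hκ⟩ := exists_move hn ν i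
    exact ⟨κ, by rw [corePoint_move hn hκ, hν, mul_apply]⟩

/-- The action on cores, transported from the action on the lattice vectors. -/
theorem exists_action {n : ℕ} [NeZero n] (hn : 2 ≤ n) :
    ∃ ρ : affineSymm n →* Equiv.Perm (Core n),
      ∀ w μ, corePoint hn (ρ w μ) = w.1 (corePoint hn μ) := by
  choose f hf using exists_core_apply (n := n) hn
  let act : MulAction (affineSymm n) (Core n) :=
    { smul := f
      one_smul := fun μ => corePoint_injective hn (hf 1 μ)
      mul_smul := fun w w' μ => corePoint_injective hn (by
        change corePoint hn (f (w * w') μ) = corePoint hn (f w (f w' μ))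
        rw [hf, hf, hf, mul_apply]) }
  exact ⟨MulAction.toPermHom (affineSymm n) (Core n), hf⟩

end ShiCore

theorem theorem6p1 (n : ℕ) [NeZero n] (hn : 2 ≤ n) :
    -- the action `ρ` of the affine symmetric group on `n`-cores by adding and removing boxes
    ∃ ρ : affineSymm n →* Equiv.Perm (Core n),
      (∀ (i : Fin n) (μ : Core n),
        (((ρ (gen n i) μ : Core n) : YoungDiagram) : Set (ℕ × ℕ)) = moveBoxes n i μ) ∧
      -- every `n`-core is `w ∅` for exactly one minimal length left coset representative `w`
      (∀ μ : Core n, ∃! w : affineSymm n, IsMinLeftCosetRep n w ∧ ρ w (emptyCore n) = μ) ∧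
      -- the map `Φ : w ∅ ↦ w⁻¹ A₀`
      ∃ Φ : Core n → Set (V n),
        (∀ w : affineSymm n, IsMinLeftCosetRep n w →
          Φ (ρ w (emptyCore n)) = alcove n w⁻¹) ∧
        -- `Φ` is a bijection from `n`-cores to alcoves in the dominant chamber
        Set.BijOn Φ Set.univ {A | IsAlcove n A ∧ A ⊆ dominantChamber n} ∧
        -- `Φ` commutes with the left action on cores and the right action
        -- `(x A₀) · g⁻¹ = x g⁻¹ A₀` on alcoves, the latter taken modulo the finite symmetric
        -- group; no passage to the quotient is needed when `x g⁻¹ A₀` is dominant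
        (∀ (g x : affineSymm n) (μ : Core n), Φ μ = alcove n x →
          (∃ u ∈ finiteSymm n, Φ (ρ g μ) = alcove n (u * (x * g⁻¹))) ∧
          (alcove n (x * g⁻¹) ⊆ dominantChamber n → Φ (ρ g μ) = alcove n (x * g⁻¹))) ∧
        ∀ m : ℕ,
          -- `Φ` restricts to a bijection onto the dominant `m`-minimal alcoves
          Set.BijOn Φ {μ | IsCore (m * n + 1) μ}
            {A | IsMMinimal n m A ∧ A ⊆ dominantChamber n} ∧
          -- which correspond bijectively to the dominant regions by containment
          (1 ≤ m →
            (∀ A, IsMMinimal n m A → A ⊆ dominantChamber n →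
              ∃! R, IsDominantShiRegion n m R ∧ A ⊆ R) ∧
            (∀ R, IsDominantShiRegion n m R → ∃! A, IsMMinimal n m A ∧ A ⊆ R)) := by
  obtain ⟨p, hp⟩ := exists_inBase n
  obtain ⟨ρ, hρ⟩ := exists_action (n := n) hn
  have hρ0 : ∀ w, corePoint hn (ρ w (emptyCore n)) = w.1 0 := fun w => by
    rw [hρ, corePoint_emptyCore]
  have hmin : ∀ w : affineSymm n, IsMinLeftCosetRep n w ↔
      StrictAnti ((w⁻¹.1 p : V n) : Fin n → ℝ) := fun w => isMinLeftCosetRep_iff hn w hp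
  have huniq : ∀ μ : Core n, ∃! w : affineSymm n,
      IsMinLeftCosetRep n w ∧ ρ w (emptyCore n) = μ := by
    intro μ
    obtain ⟨w, hw⟩ := exists_apply_zero hn (corePoint hn μ) (coreVec μ) fun j => rfl
    obtain ⟨u, hu, hs⟩ := exists_sort hn _ (isGeneric_apply hn w⁻¹ hp.isGeneric)
    refine ⟨w * u⁻¹, ⟨(hmin _).mpr ?_, corePoint_injective hn ?_⟩, ?_⟩
    · rwa [mul_inv_rev, inv_inv]
    · rw [hρ0, mul_apply, finiteSymm_apply_zero hn (inv_mem hu), hw]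
    · rintro w' ⟨h1, h2⟩
      refine eq_of_strictAnti hn (p := p) ?_ ((hmin _).mp h1) (by rwa [mul_inv_rev, inv_inv])
      rw [← hρ0, h2, mul_apply, finiteSymm_apply_zero hn (inv_mem hu), hw]
  refine ⟨ρ, fun i μ => ?_, huniq, ?_⟩
  · obtain ⟨ν, hν, hb⟩ := exists_move hn μ i
    have : ρ (gen n i) μ = ν := corePoint_injective hn (by rw [hρ, corePoint_move hn hb])
    rw [this, hν]
  choose f hf hfu using huniq
  have hf1 : ∀ μ, StrictAnti (((f μ)⁻¹.1 p : V n) : Fin n → ℝ) := fun μ => (hmin _).mp (hf μ).1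
  have hf2 : ∀ μ, (f μ).1 0 = corePoint hn μ := fun μ => by rw [← hρ0, (hf μ).2]
  -- a dominant alcove `x A₀` comes from the core of the vector `x⁻¹ 0`
  have hfx : ∀ μ (x : affineSymm n), alcove n x ⊆ dominantChamber n →
      x⁻¹.1 0 = corePoint hn μ → (f μ)⁻¹ = x := by
    intro μ x hx h0
    rw [alcove_subset_dominantChamber_iff hn hp] at hx
    rw [inv_eq_iff_eq_inv]
    exact eq_of_strictAnti hn (p := p) (by rw [hf2, h0]) (hf1 μ) (by rwa [inv_inv])
  have hdom : ∀ μ, alcove n (f μ)⁻¹ ⊆ dominantChamber n := fun μ =>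
    (alcove_subset_dominantChamber_iff hn hp).mpr (hf1 μ)
  have hinj : Function.Injective fun μ => alcove n (f μ)⁻¹ := by
    intro μ ν h
    have h1 : f μ = f ν := inv_injective (alcove_injective hn h)
    rw [← (hf μ).2, ← (hf ν).2, h1]
  have hsurj : ∀ x : affineSymm n, alcove n x ⊆ dominantChamber n → ∃ μ, (f μ)⁻¹ = x :=
    fun x hx => ⟨ρ x⁻¹ (emptyCore n), hfx _ x hx (hρ0 _).symm⟩
  have hminimal : ∀ m μ, IsMMinimal n m (alcove n (f μ)⁻¹) ↔ IsCore (m * n + 1) μ.1 := by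
    intro m μ
    rw [isCore_iff_inDilate, isMMinimal_alcove_iff hn (c := coreVec μ) _ hp (hf1 μ)]
    intro j
    rw [inv_inv, hf2, corePoint_apply]
  refine ⟨fun μ => alcove n (f μ)⁻¹, ?_, ⟨?_, hinj.injOn, ?_⟩, ?_, fun m => ⟨⟨?_, hinj.injOn, ?_⟩,
    fun hm => ⟨fun A hA hAd => existsUnique_isDominantShiRegion hn hm hA hAd,
      fun R hR => existsUnique_isMMinimal hn hR⟩⟩⟩
  · intro w hw
    change alcove n (f (ρ w (emptyCore n)))⁻¹ = _
    rw [← hfu _ w ⟨hw, rfl⟩]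
  · exact fun μ _ => ⟨(isAlcove_iff hn).mpr ⟨_, rfl⟩, hdom μ⟩
  · rintro A ⟨hA, hAd⟩
    obtain ⟨x, rfl⟩ := (isAlcove_iff hn).mp hA
    obtain ⟨μ, rfl⟩ := hsurj x hAd
    exact ⟨μ, trivial, rfl⟩
  · intro g x μ hx
    have hx : (f μ)⁻¹ = x := alcove_injective hn hx
    have h0 : ∀ u ∈ finiteSymm n, (u * (x * g⁻¹))⁻¹.1 0 = corePoint hn (ρ g μ) := by
      intro u hu
      rw [← hx, mul_inv_rev, mul_inv_rev, inv_inv, inv_inv, mul_apply,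
        finiteSymm_apply_zero hn (inv_mem hu), mul_apply, hf2, hρ]
    constructor
    · obtain ⟨u, hu, hs⟩ := exists_sort hn _ (isGeneric_apply hn (x * g⁻¹) hp.isGeneric)
      refine ⟨u, hu, ?_⟩
      change alcove n (f (ρ g μ))⁻¹ = _
      rw [hfx _ _ ((alcove_subset_dominantChamber_iff hn hp).mpr hs) (h0 u hu)]
    · intro hd
      change alcove n (f (ρ g μ))⁻¹ = _
      rw [hfx _ _ hd (by simpa using h0 1 (one_mem _))]
  · exact fun μ hμ => ⟨(hminimal m μ).mpr hμ, hdom μ⟩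
  · rintro A ⟨hA, hAd⟩
    have ⟨_, _, x, hAx, _⟩ := hA
    subst hAx
    obtain ⟨μ, rfl⟩ := hsurj x hAd
    exact ⟨μ, (hminimal m μ).mp hA, rfl⟩
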